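/- Conventions. Let $(M,[\nabla])$ be a smooth surface with a projective structure: a class of smooth torsion-free affine connections, any two of which are related by $\hat\nabla_a\omega_b=\nabla_a\omega_b-\Upsilon_a\omega_b-\Upsilon_b\omega_a$ for a smooth one-form $\Upsilon_a$. Curvature is $(\nabla_a\nabla_b-\nabla_b\nabla_a)V^c=R_{ab}{}^c{}_dV^d$, the Ricci tensor is $R_{ab}=R_{ca}{}^c{}_b$, and $\mathrm P_{ab}=\frac23R_{ab}+\frac13R_{ba}$. A solution of the projective Einstein–Weyl (pEW) equation, with respect to a connection $\nabla$ in the class, is a smooth one-form $\alpha_a$ with $\nabla_{(a}\alpha_{b)}+\alpha_a\alpha_b+\mathrm P_{(ab)}=0$. Let $U\subseteq M$ be open, and let $\nabla$ be a connection over $U$ in the projective class with a parallel volume form $\epsilon_{ab}$ on $U$; let $\epsilon^{ac}\epsilon_{bc}=\delta^a_b$. Put $Y_{abc}=\nabla_a\mathrm P_{bc}-\nabla_b\mathrm P_{ac}$, $Y_a=\epsilon^{bc}Y_{bca}$, $Y^a=\epsilon^{ab}Y_b$, $\phi=2\nabla_aY^a$, $W^a=Y^b\nabla_bY^a-\frac{2\phi}{3}Y^a$,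 $W_b=W^a\epsilon_{ab}$, $\rho=Y_aW^a$, $\ell=\frac{5\phi^2}{12}+3\mathrm P_{ac}Y^aY^c-\frac12Y^a\nabla_a\phi$, and, where $\rho\neq0$, $$a_1=15\Big(\tfrac{Y^a\nabla_a\rho}{\rho}-\tfrac{5\phi}{2}\Big),\qquad a_2=-\Big(\tfrac{3W^a\nabla_a\rho}{\rho}+6\ell-3\nabla_aW^a\Big),$$ $$a_3=\tfrac12W^a\nabla_a\phi+\tfrac{\phi}{2}\nabla_aW^a+Y^a\nabla_a\ell+\tfrac{\phi\ell}{2}-\tfrac{\phi W^a\nabla_a\rho}{2\rho}-\ell\tfrac{Y^a\nabla_a\rho}{\rho},$$ $$b_1=\tfrac{-5W^eY^d\nabla_eW_d}{\rho}+\tfrac{50\ell}{3},\qquad b_2=\tfrac{W^eW^a\nabla_eW_a}{\rho},$$ $$b_3=\tfrac{\phi W^eW^a\nabla_eW_a}{6\rho}+\mathrm P_{ea}W^eW^a+\tfrac{\ell^2}{9}+\tfrac{\ell W^eY^d\nabla_eW_d}{3\rho}+\tfrac{W^e\nabla_e\ell}{3},$$ $$c_1=\tfrac{-5Y^a(W^e\nabla_eY_a+Y^e\nabla_aW_e)}{2\rho}-\tfrac{25\phi}{6},\qquad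 c_2=\tfrac{2\ell}{3}+\tfrac{W^e(W^d\nabla_eY_d+Y^d\nabla_dW_e)}{2\rho},$$ $$c_3=-\tfrac{W^e\nabla_e\phi}{12}+\tfrac{\phi W^bW^e\nabla_eY_b}{12\rho}+\tfrac{\ell W^eY^a\nabla_eY_a}{6\rho}+\mathrm P_{ae}W^eY^a+\tfrac{Y^e\nabla_e\ell}{6}+\tfrac{\phi W^eY^a\nabla_aW_e}{12\rho}-\tfrac{\ell\phi}{18}+\tfrac{\ell Y^bY^a\nabla_aW_b}{6\rho}.$$ Let $$P_1(t)=-90t^6+a_1t^4+a_2t^2-9\rho t+a_3,\quad P_2(t)=-275t^8+b_1t^4+20\rho t^3+b_2t^2+b_3,\quad P_3(t)=-40t^6+c_1t^4+c_2t^2+\rho t+c_3,$$ $$Q_1(X)=525X^4-20c_1X^3+(b_1-20c_2)X^2+(b_2-20c_3)X+b_3,$$ $$Q_2(X)=450X^3-(9c_1+a_1)X^2-(9c_2+a_2)X-(9c_3+a_3),$$ $$Q_3(X)=475X^4-\tfrac{20}{9}a_1X^3-\big(\tfrac{20}{9}a_2+b_1\big)X^2-\big(\tfrac{20}{9}a_3+b_2\big)X-b_3.$$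 Statement. Suppose that over $U$ the pEW equation has a solution (with respect to some connection in the projective class), or that over $U$ there is a connection in the projective class whose Ricci tensor is skew-symmetric. Then at every point of $U$ at which $\rho\neq0$ (so at every point, if $\rho$ vanishes nowhere), $$\mathrm{Res}(P_1,P_2)=\mathrm{Res}(P_2,P_3)=\mathrm{Res}(P_1,P_3)=0.$$ Moreover $Q_1(t^2)=-20t^2P_3(t)+P_2(t)$, $Q_2(t^2)=-9P_3(t)-P_1(t)$, $Q_3(t^2)=-\frac{20}{9}t^2P_1(t)-P_2(t)$, and at each such point the $7\times7$ Sylvester determinants of $(Q_1,Q_2)$ and of $(Q_2,Q_3)$ and the $8\times8$ Sylvester determinant of $(Q_1,Q_3)$ vanish. -/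

import Mathlib

open scoped Manifold ContDiff Polynomial
open Bundle

noncomputable section

namespace ProjectiveSurface

/-- The model space of a surface. -/
abbrev Plane : Type := EuclideanSpace ℝ (Fin 2)

/-! ### Tensor calculus in one coordinate system

Components of tensor fields are functions on the coordinate plane. `Γ k i j` stands for the
connection coefficient with upper index `k` and lower indices `i j`, that is, the `k`-th component
of the covariant derivative of the `j`-th coordinate field along the `i`-th one. -/

/-- Connection coefficients in a coordinate system. -/
abbrev Coeffs : Type := Fin 2 → Fin 2 → Fin 2 → Plane → ℝ

/-- The partial derivative in the direction of the coordinate with index `a`. -/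
def pd (a : Fin 2) (f : Plane → ℝ) (u : Plane) : ℝ :=
  fderiv ℝ f u (EuclideanSpace.single a 1)

/-- `∇_a V^c` for a vector field `V`. -/
def covVec (Γ : Coeffs) (V : Fin 2 → Plane → ℝ) (a c : Fin 2) (u : Plane) : ℝ :=
  pd a (V c) u + ∑ b, Γ c a b u * V b u

/-- `∇_a θ_b` for a one-form `θ`. -/
def covForm (Γ : Coeffs) (θ : Fin 2 → Plane → ℝ) (a b : Fin 2) (u : Plane) : ℝ :=
  pd a (θ b) u - ∑ c, Γ c a b u * θ c u

/-- `∇_a T_bc` for a covariant two-tensor `T`. -/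
def covTwo (Γ : Coeffs) (T : Fin 2 → Fin 2 → Plane → ℝ) (a b c : Fin 2) (u : Plane) : ℝ :=
  pd a (T b c) u - ∑ d, Γ d a b u * T d c u - ∑ d, Γ d a c u * T b d u

/-- The curvature `R_ab^c_d`, with the convention
`(∇_a ∇_b - ∇_b ∇_a) V^c = R_ab^c_d V^d` for torsion-free connections. -/
def curv (Γ : Coeffs) (a b c d : Fin 2) (u : Plane) : ℝ :=
  pd a (Γ c b d) u - pd b (Γ c a d) u
    + ∑ e, (Γ c a e u * Γ e b d u - Γ c b e u * Γ e a d u)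

/-- The Ricci tensor `R_ab = R_ca^c_b`. -/
def ricci (Γ : Coeffs) (a b : Fin 2) (u : Plane) : ℝ := ∑ c, curv Γ c a c b u

/-- The projective rho tensor `P_ab = n/(n²-1) R_ab + 1/(n²-1) R_ba` in dimension `n = 2`. -/
def rhoTensor (Γ : Coeffs) (a b : Fin 2) (u : Plane) : ℝ :=
  2 / 3 * ricci Γ a b u + 1 / 3 * ricci Γ b a u

/-- The projective Cotton-York tensor `Y_abc = ∇_a P_bc - ∇_b P_ac`. -/
def cottonYork (Γ : Coeffs) (a b c : Fin 2) (u : Plane) : ℝ :=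
  covTwo Γ (rhoTensor Γ) a b c u - covTwo Γ (rhoTensor Γ) b a c u

section Invariants

/-! In what follows `ε a b` are the components of the volume form `ε_ab`. -/

variable (Γ : Coeffs) (ε : Fin 2 → Fin 2 → Plane → ℝ)

/-- The bivector `ε^ab`, determined by `ε^ac ε_bc = δ^a_b`. -/
def epsUp (a b : Fin 2) (u : Plane) : ℝ :=
  ((Matrix.of fun i j => ε i j u).transpose)⁻¹ a b

/-- `Y_a = ε^bc Y_bca`. -/
def Ylow (a : Fin 2) (u : Plane) : ℝ :=
  ∑ b, ∑ c, epsUp ε b c u * cottonYork Γ b c a u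

/-- `Y^a = ε^ab Y_b`. -/
def Yup (a : Fin 2) (u : Plane) : ℝ := ∑ b, epsUp ε a b u * Ylow Γ ε b u

/-- `φ = 2 ∇_a Y^a`. -/
def phi (u : Plane) : ℝ := 2 * ∑ a, covVec Γ (Yup Γ ε) a a u

/-- `W^a = Y^b ∇_b Y^a - (2 φ / 3) Y^a`. -/
def Wup (a : Fin 2) (u : Plane) : ℝ :=
  ∑ b, Yup Γ ε b u * covVec Γ (Yup Γ ε) b a u - 2 * phi Γ ε u / 3 * Yup Γ ε a u

/-- `W_b = W^a ε_ab`. -/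
def Wlow (b : Fin 2) (u : Plane) : ℝ := ∑ a, Wup Γ ε a u * ε a b u

/-- `ρ = Y_a W^a`. -/
def rho (u : Plane) : ℝ := ∑ a, Ylow Γ ε a u * Wup Γ ε a u

/-- `Y^a ∇_a f` for a function `f`. -/
def dY (f : Plane → ℝ) (u : Plane) : ℝ := ∑ a, Yup Γ ε a u * pd a f u

/-- `W^a ∇_a f` for a function `f`. -/
def dW (f : Plane → ℝ) (u : Plane) : ℝ := ∑ a, Wup Γ ε a u * pd a f u

/-- `∇_a W^a`. -/
def divW (u : Plane) : ℝ := ∑ a, covVec Γ (Wup Γ ε) a a u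

/-- `ℓ = 5 φ² / 12 + 3 P_ac Y^a Y^c - Y^a ∇_a φ / 2`. -/
def ell (u : Plane) : ℝ :=
  5 * phi Γ ε u ^ 2 / 12
    + 3 * ∑ a, ∑ c, rhoTensor Γ a c u * Yup Γ ε a u * Yup Γ ε c u
    - dY Γ ε (phi Γ ε) u / 2

/-- `U^e V^d ∇_e θ_d` for vector fields `U`, `V` and a one-form `θ`. -/
def contr (U V θ : Fin 2 → Plane → ℝ) (u : Plane) : ℝ :=
  ∑ e, ∑ d, U e u * V d u * covForm Γ θ e d u

/-- The coefficient of degree four of `P₁`. -/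
def a₁ (u : Plane) : ℝ :=
  15 * (dY Γ ε (rho Γ ε) u / rho Γ ε u - 5 * phi Γ ε u / 2)

/-- The coefficient of degree two of `P₁`. -/
def a₂ (u : Plane) : ℝ :=
  -(3 * dW Γ ε (rho Γ ε) u / rho Γ ε u + 6 * ell Γ ε u - 3 * divW Γ ε u)

/-- The constant coefficient of `P₁`. -/
def a₃ (u : Plane) : ℝ :=
  (dW Γ ε (phi Γ ε) u / 2 + phi Γ ε u / 2 * divW Γ ε u + dY Γ ε (ell Γ ε) u
      + phi Γ ε u * ell Γ ε u / 2)
    - phi Γ ε u * dW Γ ε (rho Γ ε) u / (2 * rho Γ ε u)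
    - ell Γ ε u * (dY Γ ε (rho Γ ε) u / rho Γ ε u)

/-- The coefficient of degree four of `P₂`. -/
def b₁ (u : Plane) : ℝ :=
  -5 * contr Γ (Wup Γ ε) (Yup Γ ε) (Wlow Γ ε) u / rho Γ ε u + 50 * ell Γ ε u / 3

/-- The coefficient of degree two of `P₂`. -/
def b₂ (u : Plane) : ℝ :=
  contr Γ (Wup Γ ε) (Wup Γ ε) (Wlow Γ ε) u / rho Γ ε u

/-- The constant coefficient of `P₂`. -/
def b₃ (u : Plane) : ℝ :=
  phi Γ ε u * contr Γ (Wup Γ ε) (Wup Γ ε) (Wlow Γ ε) u / (6 * rho Γ ε u)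
    + ∑ e, ∑ a, rhoTensor Γ e a u * Wup Γ ε e u * Wup Γ ε a u
    + ell Γ ε u ^ 2 / 9
    + ell Γ ε u * contr Γ (Wup Γ ε) (Yup Γ ε) (Wlow Γ ε) u / (3 * rho Γ ε u)
    + dW Γ ε (ell Γ ε) u / 3

/-- The coefficient of degree four of `P₃`. -/
def c₁ (u : Plane) : ℝ :=
  -5 * (contr Γ (Wup Γ ε) (Yup Γ ε) (Ylow Γ ε) u + contr Γ (Yup Γ ε) (Yup Γ ε) (Wlow Γ ε) u)
      / (2 * rho Γ ε u)
    - 25 * phi Γ ε u / 6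

/-- The coefficient of degree two of `P₃`. -/
def c₂ (u : Plane) : ℝ :=
  2 * ell Γ ε u / 3
    + (contr Γ (Wup Γ ε) (Wup Γ ε) (Ylow Γ ε) u + contr Γ (Yup Γ ε) (Wup Γ ε) (Wlow Γ ε) u)
      / (2 * rho Γ ε u)

/-- The constant coefficient of `P₃`. -/
def c₃ (u : Plane) : ℝ :=
  -dW Γ ε (phi Γ ε) u / 12
    + phi Γ ε u * contr Γ (Wup Γ ε) (Wup Γ ε) (Ylow Γ ε) u / (12 * rho Γ ε u)
    + ell Γ ε u * contr Γ (Wup Γ ε) (Yup Γ ε) (Ylow Γ ε) u / (6 * rho Γ ε u)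
    + ∑ a, ∑ e, rhoTensor Γ a e u * Wup Γ ε e u * Yup Γ ε a u
    + dY Γ ε (ell Γ ε) u / 6
    + phi Γ ε u * contr Γ (Yup Γ ε) (Wup Γ ε) (Wlow Γ ε) u / (12 * rho Γ ε u)
    - ell Γ ε u * phi Γ ε u / 18
    + ell Γ ε u * contr Γ (Yup Γ ε) (Yup Γ ε) (Wlow Γ ε) u / (6 * rho Γ ε u)

open Polynomial in
/-- The polynomial `P₁(t)` at a point. -/
def P₁ (u : Plane) : ℝ[X] :=
  C (-90) * X ^ 6 + C (a₁ Γ ε u) * X ^ 4 + C (a₂ Γ ε u) * X ^ 2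
    + C (-9 * rho Γ ε u) * X + C (a₃ Γ ε u)

open Polynomial in
/-- The polynomial `P₂(t)` at a point. -/
def P₂ (u : Plane) : ℝ[X] :=
  C (-275) * X ^ 8 + C (b₁ Γ ε u) * X ^ 4 + C (20 * rho Γ ε u) * X ^ 3
    + C (b₂ Γ ε u) * X ^ 2 + C (b₃ Γ ε u)

open Polynomial in
/-- The polynomial `P₃(t)` at a point. -/
def P₃ (u : Plane) : ℝ[X] :=
  C (-40) * X ^ 6 + C (c₁ Γ ε u) * X ^ 4 + C (c₂ Γ ε u) * X ^ 2
    + C (rho Γ ε u) * X + C (c₃ Γ ε u)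

/-- The coefficients of `Q₁`, from degree four down to degree zero. -/
def q₁ (u : Plane) : Fin 5 → ℝ :=
  ![525, -20 * c₁ Γ ε u, b₁ Γ ε u - 20 * c₂ Γ ε u, b₂ Γ ε u - 20 * c₃ Γ ε u, b₃ Γ ε u]

/-- The coefficients of `Q₂`, from degree three down to degree zero. -/
def q₂ (u : Plane) : Fin 4 → ℝ :=
  ![450, -(9 * c₁ Γ ε u + a₁ Γ ε u), -(9 * c₂ Γ ε u + a₂ Γ ε u), -(9 * c₃ Γ ε u + a₃ Γ ε u)]

/-- The coefficients of `Q₃`, from degree four down to degree zero. -/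
def q₃ (u : Plane) : Fin 5 → ℝ :=
  ![475, -(20 / 9) * a₁ Γ ε u, -(20 / 9 * a₂ Γ ε u + b₁ Γ ε u),
    -(20 / 9 * a₃ Γ ε u + b₂ Γ ε u), -b₃ Γ ε u]

open Polynomial in
/-- The polynomial `Q₁(X)`, where `X = t²`. -/
def Q₁ (u : Plane) : ℝ[X] := ∑ i : Fin 5, C (q₁ Γ ε u i) * X ^ (4 - (i : ℕ))

open Polynomial in
/-- The polynomial `Q₂(X)`, where `X = t²`. -/
def Q₂ (u : Plane) : ℝ[X] := ∑ i : Fin 4, C (q₂ Γ ε u i) * X ^ (3 - (i : ℕ))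

open Polynomial in
/-- The polynomial `Q₃(X)`, where `X = t²`. -/
def Q₃ (u : Plane) : ℝ[X] := ∑ i : Fin 5, C (q₃ Γ ε u i) * X ^ (4 - (i : ℕ))

end Invariants

/-- The `7 × 7` Sylvester matrix of a quartic `p` and a cubic `q`, given by their coefficients in
descending order. -/
def sylvester43 (p : Fin 5 → ℝ) (q : Fin 4 → ℝ) : Matrix (Fin 7) (Fin 7) ℝ :=
  !![p 0, p 1, p 2, p 3, p 4, 0, 0;
     0, p 0, p 1, p 2, p 3, p 4, 0;
     0, 0, p 0, p 1, p 2, p 3, p 4;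
     q 0, q 1, q 2, q 3, 0, 0, 0;
     0, q 0, q 1, q 2, q 3, 0, 0;
     0, 0, q 0, q 1, q 2, q 3, 0;
     0, 0, 0, q 0, q 1, q 2, q 3]

/-- The `7 × 7` Sylvester matrix of a cubic `p` and a quartic `q`. -/
def sylvester34 (p : Fin 4 → ℝ) (q : Fin 5 → ℝ) : Matrix (Fin 7) (Fin 7) ℝ :=
  !![p 0, p 1, p 2, p 3, 0, 0, 0;
     0, p 0, p 1, p 2, p 3, 0, 0;
     0, 0, p 0, p 1, p 2, p 3, 0;
     0, 0, 0, p 0, p 1, p 2, p 3;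
     q 0, q 1, q 2, q 3, q 4, 0, 0;
     0, q 0, q 1, q 2, q 3, q 4, 0;
     0, 0, q 0, q 1, q 2, q 3, q 4]

/-- The `8 × 8` Sylvester matrix of two quartics. -/
def sylvester44 (p q : Fin 5 → ℝ) : Matrix (Fin 8) (Fin 8) ℝ :=
  !![p 0, p 1, p 2, p 3, p 4, 0, 0, 0;
     0, p 0, p 1, p 2, p 3, p 4, 0, 0;
     0, 0, p 0, p 1, p 2, p 3, p 4, 0;
     0, 0, 0, p 0, p 1, p 2, p 3, p 4;
     q 0, q 1, q 2, q 3, q 4, 0, 0, 0;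
     0, q 0, q 1, q 2, q 3, q 4, 0, 0;
     0, 0, q 0, q 1, q 2, q 3, q 4, 0;
     0, 0, 0, q 0, q 1, q 2, q 3, q 4]

/-! ### Connections and tensor fields on a surface -/

section Surface

variable {M : Type*} [TopologicalSpace M] [ChartedSpace Plane M] [IsManifold (𝓡 2) ∞ M]

variable (M) in
/-- Affine connections on `M`: covariant derivatives on the tangent bundle. -/
abbrev AffineConnection : Type _ :=
  CovariantDerivative (𝓡 2) Plane (TangentSpace (𝓡 2) : M → Type _)

variable (M) in
/-- The smooth charts of the surface. -/
abbrev charts : Set (OpenPartialHomeomorph M Plane) := IsManifold.maximalAtlas (𝓡 2) ∞ M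

/-- The coordinate vector field `∂_i` of a chart (only its values on the source matter). -/
def coordField (e : OpenPartialHomeomorph M Plane) (i : Fin 2) :
    Π x : M, TangentSpace (𝓡 2) x :=
  fun x => (mfderiv (𝓡 2) (𝓡 2) e x).inverse (EuclideanSpace.single i (1 : ℝ) : Plane)

/-- The `k`-th component in a chart of a tangent vector at `x`. -/
def comp (e : OpenPartialHomeomorph M Plane) (k : Fin 2) {x : M}
    (v : TangentSpace (𝓡 2) x) : ℝ :=
  (show Plane from mfderiv (𝓡 2) (𝓡 2) e x v) k

/-- The connection coefficients of a connection in a chart. -/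
def coeffs (D : AffineConnection M) (e : OpenPartialHomeomorph M Plane) : Coeffs :=
  fun k i j u => comp e k (D (coordField e j) (e.symm u) (coordField e i (e.symm u)))

/-- The components of a one-form in a chart. -/
def formComp (θ : Π x : M, TangentSpace (𝓡 2) x →L[ℝ] ℝ)
    (e : OpenPartialHomeomorph M Plane) : Fin 2 → Plane → ℝ :=
  fun i u => θ (e.symm u) (coordField e i (e.symm u))

/-- The components of a two-form in a chart. -/
def twoFormComp (ε : Π x : M, TangentSpace (𝓡 2) x [⋀^Fin 2]→ₗ[ℝ] ℝ)
    (e : OpenPartialHomeomorph M Plane) : Fin 2 → Fin 2 → Plane → ℝ :=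
  fun i j u => ε (e.symm u) ![coordField e i (e.symm u), coordField e j (e.symm u)]

/-- The image in the coordinate plane of the part of `U` covered by a chart. -/
def chartDomain (e : OpenPartialHomeomorph M Plane) (U : Set M) : Set Plane :=
  e.target ∩ e.symm ⁻¹' U

/-- `θ` restricts to a smooth one-form on `U`. -/
def IsSmoothOneFormOn (U : Set M) (θ : Π x : M, TangentSpace (𝓡 2) x →L[ℝ] ℝ) : Prop :=
  ∀ e ∈ charts M, ∀ i, ContDiffOn ℝ ∞ (formComp θ e i) (chartDomain e U)

/-- `ε` restricts to a volume form on `U`: a smooth, nowhere vanishing two-form. -/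
def IsVolumeFormOn (U : Set M)
    (ε : Π x : M, TangentSpace (𝓡 2) x [⋀^Fin 2]→ₗ[ℝ] ℝ) : Prop :=
  (∀ e ∈ charts M, ∀ i j, ContDiffOn ℝ ∞ (twoFormComp ε e i j) (chartDomain e U)) ∧
    ∀ x ∈ U, ε x ≠ 0

/-- `∇_a ε_bc = 0` on `U`. -/
def IsParallelOn (U : Set M) (D : AffineConnection M)
    (ε : Π x : M, TangentSpace (𝓡 2) x [⋀^Fin 2]→ₗ[ℝ] ℝ) : Prop :=
  ∀ e ∈ charts M, ∀ u ∈ chartDomain e U, ∀ a b c,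
    covTwo (coeffs D e) (twoFormComp ε e) a b c u = 0

/-- `D` restricts to a smooth torsion-free connection on `U`. -/
structure IsTorsionFreeConnectionOn (U : Set M) (D : AffineConnection M) : Prop where
  smooth : ContMDiffCovariantDerivativeOn Plane ∞ D.toFun U
  torsion_eq_zero : ∀ x ∈ U, D.torsion x = 0

/-- Projective equivalence over `U`: for some smooth one-form `Υ` on `U`,
`D'_X σ = D_X σ + Υ(X) σ + Υ(σ) X` for vector fields, which is equivalent to
`D'_a θ_b = D_a θ_b - Υ_a θ_b - Υ_b θ_a` for one-forms. -/
def ProjectivelyEquivalentOn (U : Set M) (D D' : AffineConnection M) : Prop :=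
  ∃ Υ : Π x : M, TangentSpace (𝓡 2) x →L[ℝ] ℝ, IsSmoothOneFormOn U Υ ∧
    ∀ x ∈ U, ∀ σ : Π x : M, TangentSpace (𝓡 2) x,
      MDifferentiableAt (𝓡 2) (𝓡 2).tangent (fun y => (⟨y, σ y⟩ : TangentBundle (𝓡 2) M)) x →
      ∀ v : TangentSpace (𝓡 2) x, D' σ x v = D σ x v + Υ x v • σ x + Υ x (σ x) • v

variable (M) in
/-- A projective structure on a surface: a projective equivalence class of smooth torsion-free
connections. -/
structure ProjectiveStructure where
  /-- The connections in the class. -/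
  carrier : Set (AffineConnection M)
  isClass : ∃ D₀ : AffineConnection M, IsTorsionFreeConnectionOn Set.univ D₀ ∧
    carrier = {D | IsTorsionFreeConnectionOn Set.univ D ∧ ProjectivelyEquivalentOn Set.univ D₀ D}

/-- Over the open set `U`, `D` is a connection in the restriction of the projective class to `U`
(the values of `D` outside `U` are irrelevant). -/
def ProjectiveStructure.MemOn (p : ProjectiveStructure M) (U : Set M)
    (D : AffineConnection M) : Prop :=
  IsTorsionFreeConnectionOn U D ∧ ∃ D₀ ∈ p.carrier, ProjectivelyEquivalentOn U D₀ D

/-- The projective Einstein-Weyl equation `∇_(a α_b) + α_a α_b + P_(ab) = 0` on `U`. -/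
def SolvesPEWOn (U : Set M) (D : AffineConnection M)
    (α : Π x : M, TangentSpace (𝓡 2) x →L[ℝ] ℝ) : Prop :=
  ∀ e ∈ charts M, ∀ u ∈ chartDomain e U, ∀ a b,
    (covForm (coeffs D e) (formComp α e) a b u + covForm (coeffs D e) (formComp α e) b a u) / 2
      + formComp α e a u * formComp α e b u
      + (rhoTensor (coeffs D e) a b u + rhoTensor (coeffs D e) b a u) / 2 = 0

/-- The Ricci tensor of `D` is skew-symmetric on `U`. -/
def HasSkewRicciOn (U : Set M) (D : AffineConnection M) : Prop :=
  ∀ e ∈ charts M, ∀ u ∈ chartDomain e U, ∀ a b,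
    ricci (coeffs D e) a b u = -ricci (coeffs D e) b a u

/-- The projective surface admits a solution of the pEW equation over `U`, relative to some
connection of the projective class. -/
def AdmitsPEWSolutionOn (p : ProjectiveStructure M) (U : Set M) : Prop :=
  ∃ D : AffineConnection M, p.MemOn U D ∧
    ∃ α : Π x : M, TangentSpace (𝓡 2) x →L[ℝ] ℝ, IsSmoothOneFormOn U α ∧ SolvesPEWOn U D α

/-- Over `U` there is a connection in the projective class with skew-symmetric Ricci tensor. -/
def AdmitsSkewRicciOn (p : ProjectiveStructure M) (U : Set M) : Prop :=
  ∃ D : AffineConnection M, p.MemOn U D ∧ HasSkewRicciOn U D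

end Surface

end ProjectiveSurface

end

noncomputable section

namespace ProjectiveSurface

/-! ### Partial derivatives -/

/-! Prolongation turns the overdetermined pEW equation into algebraic conditions on one scalar. The
equation is projectively invariant (`SolvesPEWIn.of_projective_change`), and a skew Ricci tensor
makes `α = 0` a solution for its own connection, so either hypothesis yields a solution `α` relative
to the connection preserving `ε`, whose Ricci tensor is symmetric. Write `∇_a α_b = -α_a α_b - P_ab
+ F ε_ab`.

Commuting derivatives of `α` gives `∇_b F = -3 F α_b - Y_b / 2` (`pd_curl`), and commuting
derivatives of `F` gives `Y^a α_a = -4 F² - φ / 6` (`Yup_contr`). Differentiating this along `Y`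
gives `W^a α_a = -80 F⁴ + ℓ / 3` (`Wup_contr`).

Three further relations arise from the first contraction differentiated along `W` and from the
second differentiated along `Y` and `W`. Where `ρ ≠ 0` the fields `Y` and `W` form a frame, so every
remaining contraction with `α` is expressed through these two and becomes a polynomial in `F`
(`contr_expand`). The results say that `t = 2F` is a common root of `P₁`, `P₂` and `P₃`
(`eval_eq_zero`). The resultants therefore vanish. The `Q_i` are combinations free of odd powers of
`t`, so they share the root `t²`, and their Sylvester matrices are singular. -/

theorem pd_congr {O : Set Plane} (hO : IsOpen O) {f g : Plane → ℝ} (h : ∀ v ∈ O, f v = g v)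
    {u : Plane} (hu : u ∈ O) (a : Fin 2) : pd a f u = pd a g u := by
  have : f =ᶠ[nhds u] g := Filter.eventuallyEq_of_mem (hO.mem_nhds hu) h
  simp only [pd, this.fderiv_eq]

theorem pd_add {f g : Plane → ℝ} {u : Plane} (hf : DifferentiableAt ℝ f u)
    (hg : DifferentiableAt ℝ g u) (a : Fin 2) :
    pd a (fun v => f v + g v) u = pd a f u + pd a g u := by
  simp [pd, fderiv_fun_add hf hg]

theorem pd_sub {f g : Plane → ℝ} {u : Plane} (hf : DifferentiableAt ℝ f u)
    (hg : DifferentiableAt ℝ g u) (a : Fin 2) :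
    pd a (fun v => f v - g v) u = pd a f u - pd a g u := by
  simp [pd, fderiv_fun_sub hf hg]

theorem pd_mul {f g : Plane → ℝ} {u : Plane} (hf : DifferentiableAt ℝ f u)
    (hg : DifferentiableAt ℝ g u) (a : Fin 2) :
    pd a (fun v => f v * g v) u = pd a f u * g u + f u * pd a g u := by
  simp [pd, fderiv_fun_mul hf hg]; ring

theorem pd_neg (f : Plane → ℝ) (u : Plane) (a : Fin 2) :
    pd a (fun v => -f v) u = -pd a f u := by
  simp [pd, fderiv_fun_neg]

theorem pd_const (c : ℝ) (u : Plane) (a : Fin 2) : pd a (fun _ => c) u = 0 := by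
  simp [pd]

theorem contDiffOn_pd {O : Set Plane} (hO : IsOpen O) {f : Plane → ℝ}
    (hf : ContDiffOn ℝ ∞ f O) (a : Fin 2) : ContDiffOn ℝ ∞ (pd a f) O :=
  (hf.fderiv_of_isOpen hO (m := ∞) (by simp)).clm_apply contDiffOn_const

theorem differentiableAt_of_contDiffOn {O : Set Plane} (hO : IsOpen O) {f : Plane → ℝ}
    (hf : ContDiffOn ℝ ∞ f O) {u : Plane} (hu : u ∈ O) : DifferentiableAt ℝ f u :=
  (hf.contDiffAt (hO.mem_nhds hu)).differentiableAt (by simp)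

theorem pd_comm {O : Set Plane} (hO : IsOpen O) {f : Plane → ℝ}
    (hf : ContDiffOn ℝ ∞ f O) {u : Plane} (hu : u ∈ O) (a b : Fin 2) :
    pd a (pd b f) u = pd b (pd a f) u := by
  have hc := hf.contDiffAt (hO.mem_nhds hu)
  have hc : ContDiffAt ℝ 2 f u := contDiffAt_infty.1 hc 2
  have hs : IsSymmSndFDerivAt ℝ f u := hc.isSymmSndFDerivAt (by simp)
  have hd : DifferentiableAt ℝ (fderiv ℝ f) u :=
    (hc.fderiv_right (m := 1) (by norm_num)).differentiableAt (by simp)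
  have key : ∀ a b, pd a (pd b f) u
      = fderiv ℝ (fderiv ℝ f) u (EuclideanSpace.single a 1) (EuclideanSpace.single b 1) := by
    intro a b
    have : pd b f = fun v => fderiv ℝ f v (EuclideanSpace.single b 1) := rfl
    rw [this, pd, fderiv_clm_apply hd (by fun_prop)]
    simp
  rw [key, key]
  exact hs.eq _ _

/-- In the coordinate domain `O`, the coefficients `Γ` are those of a smooth torsion-free connection
for which the volume form `ε` is parallel. -/
structure IsUnimodularOn (O : Set Plane) (Γ : Coeffs) (ε : Fin 2 → Fin 2 → Plane → ℝ) : Prop where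
  isOpen : IsOpen O
  smooth : ∀ k i j, ContDiffOn ℝ ∞ (Γ k i j) O
  symm : ∀ k i j, ∀ u ∈ O, Γ k i j u = Γ k j i u
  smooth_eps : ∀ i j, ContDiffOn ℝ ∞ (ε i j) O
  antisymm : ∀ i j u, ε i j u = -ε j i u
  ne_zero : ∀ u ∈ O, ε 0 1 u ≠ 0
  parallel : ∀ u ∈ O, ∀ a b c, covTwo Γ ε a b c u = 0

/-! ### Connections with a parallel volume form: symmetric Ricci tensor and smooth invariants. -/

namespace IsUnimodularOn

variable {O : Set Plane} {Γ : Coeffs} {ε : Fin 2 → Fin 2 → Plane → ℝ}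

theorem eps_self (h : IsUnimodularOn O Γ ε) (i : Fin 2) (u : Plane) : ε i i u = 0 := by
  linarith [h.antisymm i i u]

theorem differentiableAt (h : IsUnimodularOn O Γ ε) {u : Plane} (hu : u ∈ O) (k i j : Fin 2) :
    DifferentiableAt ℝ (Γ k i j) u :=
  differentiableAt_of_contDiffOn h.isOpen (h.smooth k i j) hu

theorem differentiableAt_eps (h : IsUnimodularOn O Γ ε) {u : Plane} (hu : u ∈ O) (i j : Fin 2) :
    DifferentiableAt ℝ (ε i j) u :=
  differentiableAt_of_contDiffOn h.isOpen (h.smooth_eps i j) hu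

theorem pd_symm (h : IsUnimodularOn O Γ ε) {u : Plane} (hu : u ∈ O) (a k i j : Fin 2) :
    pd a (Γ k i j) u = pd a (Γ k j i) u :=
  pd_congr h.isOpen (h.symm k i j) hu a

theorem pd_eps (h : IsUnimodularOn O Γ ε) {u : Plane} (hu : u ∈ O) (a : Fin 2) :
    pd a (ε 0 1) u = (Γ 0 a 0 u + Γ 1 a 1 u) * ε 0 1 u := by
  have := h.parallel u hu a 0 1
  simp only [covTwo, Fin.sum_univ_two, h.eps_self] at this
  linear_combination this

/-- By `pd_eps` the trace of the connection coefficients is the gradient of `log |ε 0 1|`, hence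
closed. Its curl is the skew part of the Ricci tensor, which therefore vanishes. -/
theorem pd_trace (h : IsUnimodularOn O Γ ε) {u : Plane} (hu : u ∈ O) :
    pd 0 (Γ 0 1 0) u + pd 0 (Γ 1 1 1) u = pd 1 (Γ 0 0 0) u + pd 1 (Γ 1 0 1) u := by
  have h1 := pd_comm h.isOpen (h.smooth_eps 0 1) hu 0 1
  rw [pd_congr h.isOpen (fun v hv => h.pd_eps hv 1) hu,
    pd_congr h.isOpen (fun v hv => h.pd_eps hv 0) hu] at h1
  have d := h.differentiableAt hu
  have dε := h.differentiableAt_eps hu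
  simp (disch := fun_prop) only [pd_add, pd_mul, h.pd_eps hu] at h1
  have h0 := h.ne_zero u hu
  apply mul_right_cancel₀ h0
  linear_combination h1

theorem ricci_symm (h : IsUnimodularOn O Γ ε) {u : Plane} (hu : u ∈ O) (a b : Fin 2) :
    ricci Γ a b u = ricci Γ b a u := by
  have key : ricci Γ 0 1 u = ricci Γ 1 0 u := by
    simp only [ricci, curv, Fin.sum_univ_two]
    linear_combination -h.pd_trace hu
  fin_cases a <;> fin_cases b <;> simp [key]

theorem rhoTensor_eq (h : IsUnimodularOn O Γ ε) {u : Plane} (hu : u ∈ O) (a b : Fin 2) :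
    rhoTensor Γ a b u = ricci Γ a b u := by
  rw [rhoTensor, h.ricci_symm hu b a]; ring

theorem rhoTensor_symm (h : IsUnimodularOn O Γ ε) {u : Plane} (hu : u ∈ O) (a b : Fin 2) :
    rhoTensor Γ a b u = rhoTensor Γ b a u := by
  rw [h.rhoTensor_eq hu, h.rhoTensor_eq hu, h.ricci_symm hu]

/-- For a symmetric Ricci tensor, `R_01^c_d = δ_0^c P_1d - δ_1^c P_0d`. -/
theorem curv_eq (h : IsUnimodularOn O Γ ε) {u : Plane} (hu : u ∈ O) (d : Fin 2) :
    curv Γ 0 1 0 d u = rhoTensor Γ 1 d u ∧ curv Γ 0 1 1 d u = -rhoTensor Γ 0 d u := by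
  simp only [h.rhoTensor_eq hu, ricci, curv, Fin.sum_univ_two]
  constructor <;> ring

theorem smooth_ricci (hO : IsOpen O) (hΓ : ∀ k i j, ContDiffOn ℝ ∞ (Γ k i j) O) (a b : Fin 2) :
    ContDiffOn ℝ ∞ (ricci Γ a b) O := by
  have hp : ∀ a k i j, ContDiffOn ℝ ∞ (pd a (Γ k i j)) O := fun a k i j =>
    contDiffOn_pd hO (hΓ k i j) a
  have : ricci Γ a b = fun u => ∑ c, curv Γ c a c b u := rfl
  simp only [this, curv, Fin.sum_univ_two]
  fun_prop

theorem smooth_rhoTensor (h : IsUnimodularOn O Γ ε) (a b : Fin 2) :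
    ContDiffOn ℝ ∞ (rhoTensor Γ a b) O := by
  have hr := smooth_ricci h.isOpen h.smooth
  have : rhoTensor Γ a b = fun u => 2 / 3 * ricci Γ a b u + 1 / 3 * ricci Γ b a u := rfl
  rw [this]
  fun_prop

/-- No non-vanishing is needed: for a singular matrix both the matrix inverse and the scalar inverse
are zero by convention. -/
theorem epsUp_eq (h : IsUnimodularOn O Γ ε) (u : Plane) :
    epsUp ε 0 0 u = 0 ∧ epsUp ε 1 1 u = 0 ∧ epsUp ε 0 1 u = (ε 0 1 u)⁻¹ ∧
      epsUp ε 1 0 u = -(ε 0 1 u)⁻¹ := by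
  have h1 : ε 1 0 u = -ε 0 1 u := h.antisymm 1 0 u
  have h00 := h.eps_self 0 u
  have h11 := h.eps_self 1 u
  by_cases h0 : ε 0 1 u = 0
  all_goals
    simp [epsUp, Matrix.inv_def, Matrix.det_fin_two, Matrix.adjugate_fin_two, h1, h00, h11, h0]

theorem Ylow_eq (h : IsUnimodularOn O Γ ε) (a : Fin 2) (u : Plane) :
    Ylow Γ ε a u = 2 * ((ε 0 1 u)⁻¹ * cottonYork Γ 0 1 a u) := by
  obtain ⟨e00, e11, e01, e10⟩ := h.epsUp_eq u
  simp only [Ylow, Fin.sum_univ_two, e00, e11, e01, e10, cottonYork]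
  ring

theorem Yup_eq (h : IsUnimodularOn O Γ ε) (u : Plane) :
    Yup Γ ε 0 u = (ε 0 1 u)⁻¹ * Ylow Γ ε 1 u ∧ Yup Γ ε 1 u = -((ε 0 1 u)⁻¹ * Ylow Γ ε 0 u) := by
  obtain ⟨e00, e11, e01, e10⟩ := h.epsUp_eq u
  simp only [Yup, Fin.sum_univ_two, e00, e11, e01, e10]
  constructor <;> ring

theorem Ylow_eq_Yup (h : IsUnimodularOn O Γ ε) {u : Plane} (hu : u ∈ O) :
    Ylow Γ ε 0 u = -(ε 0 1 u * Yup Γ ε 1 u) ∧ Ylow Γ ε 1 u = ε 0 1 u * Yup Γ ε 0 u := by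
  have h0 := h.ne_zero u hu
  rw [(h.Yup_eq u).1, (h.Yup_eq u).2]
  constructor <;> field_simp

theorem Wlow_eq (h : IsUnimodularOn O Γ ε) (u : Plane) :
    Wlow Γ ε 0 u = -(ε 0 1 u * Wup Γ ε 1 u) ∧ Wlow Γ ε 1 u = ε 0 1 u * Wup Γ ε 0 u := by
  simp only [Wlow, Fin.sum_univ_two, h.eps_self, h.antisymm 1 0 u]
  constructor <;> ring

theorem smooth_Ylow (h : IsUnimodularOn O Γ ε) (a : Fin 2) :
    ContDiffOn ℝ ∞ (Ylow Γ ε a) O := by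
  have hr := h.smooth_rhoTensor
  have hΓ := h.smooth
  have hp : ∀ a i j, ContDiffOn ℝ ∞ (pd a (rhoTensor Γ i j)) O := fun a i j =>
    contDiffOn_pd h.isOpen (hr i j) a
  have hi : ContDiffOn ℝ ∞ (fun u => (ε 0 1 u)⁻¹) O := (h.smooth_eps 0 1).inv h.ne_zero
  have : Ylow Γ ε a = fun u => 2 * ((ε 0 1 u)⁻¹ * cottonYork Γ 0 1 a u) :=
    funext (h.Ylow_eq a)
  simp only [this, cottonYork, covTwo, Fin.sum_univ_two]
  fun_prop

theorem smooth_Yup (h : IsUnimodularOn O Γ ε) (a : Fin 2) :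
    ContDiffOn ℝ ∞ (Yup Γ ε a) O := by
  have hY := h.smooth_Ylow
  have hi : ContDiffOn ℝ ∞ (fun u => (ε 0 1 u)⁻¹) O := (h.smooth_eps 0 1).inv h.ne_zero
  fin_cases a
  · have : Yup Γ ε 0 = _ := funext fun u => (h.Yup_eq u).1
    simp only [Fin.zero_eta, this]
    fun_prop
  · have : Yup Γ ε 1 = _ := funext fun u => (h.Yup_eq u).2
    simp only [Fin.mk_one, this]
    fun_prop

theorem smooth_covVec (h : IsUnimodularOn O Γ ε) {V : Fin 2 → Plane → ℝ}
    (hV : ∀ a, ContDiffOn ℝ ∞ (V a) O) (a c : Fin 2) : ContDiffOn ℝ ∞ (covVec Γ V a c) O := by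
  have hΓ := h.smooth
  have hp : ∀ a i, ContDiffOn ℝ ∞ (pd a (V i)) O := fun a i => contDiffOn_pd h.isOpen (hV i) a
  have : covVec Γ V a c = fun u => pd a (V c) u + ∑ b, Γ c a b u * V b u := rfl
  simp only [this, Fin.sum_univ_two]
  fun_prop

theorem smooth_phi (h : IsUnimodularOn O Γ ε) : ContDiffOn ℝ ∞ (phi Γ ε) O := by
  have hY := h.smooth_covVec h.smooth_Yup
  have : phi Γ ε = fun u => 2 * ∑ a, covVec Γ (Yup Γ ε) a a u := rfl
  simp only [this, Fin.sum_univ_two]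
  fun_prop

theorem smooth_Wup (h : IsUnimodularOn O Γ ε) (a : Fin 2) : ContDiffOn ℝ ∞ (Wup Γ ε a) O := by
  have hY := h.smooth_covVec h.smooth_Yup
  have hY' := h.smooth_Yup
  have hφ := h.smooth_phi
  have : Wup Γ ε a = fun u => ∑ b, Yup Γ ε b u * covVec Γ (Yup Γ ε) b a u
    - 2 * phi Γ ε u / 3 * Yup Γ ε a u := rfl
  simp only [this, Fin.sum_univ_two]
  fun_prop

theorem smooth_ell (h : IsUnimodularOn O Γ ε) : ContDiffOn ℝ ∞ (ell Γ ε) O := by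
  have hY' := h.smooth_Yup
  have hφ := h.smooth_phi
  have hr := h.smooth_rhoTensor
  have hp : ∀ a, ContDiffOn ℝ ∞ (pd a (phi Γ ε)) O := fun a => contDiffOn_pd h.isOpen hφ a
  have : ell Γ ε = fun u => 5 * phi Γ ε u ^ 2 / 12
    + 3 * ∑ a, ∑ c, rhoTensor Γ a c u * Yup Γ ε a u * Yup Γ ε c u
    - dY Γ ε (phi Γ ε) u / 2 := rfl
  simp only [this, dY, Fin.sum_univ_two]
  fun_prop

/-- Lowering an index with a parallel volume form commutes with covariant differentiation. -/
theorem covForm_lower (h : IsUnimodularOn O Γ ε) {V θ : Fin 2 → Plane → ℝ}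
    (hV : ∀ a, ContDiffOn ℝ ∞ (V a) O)
    (hθ : ∀ u ∈ O, θ 0 u = -(ε 0 1 u * V 1 u) ∧ θ 1 u = ε 0 1 u * V 0 u)
    {u : Plane} (hu : u ∈ O) (a : Fin 2) :
    covForm Γ θ a 0 u = -(ε 0 1 u * covVec Γ V a 1 u) ∧
      covForm Γ θ a 1 u = ε 0 1 u * covVec Γ V a 0 u := by
  have d := fun a => differentiableAt_of_contDiffOn h.isOpen (hV a) hu
  have dε := h.differentiableAt_eps hu
  have h0 := pd_congr h.isOpen (fun v hv => (hθ v hv).1) hu a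
  have h1 := pd_congr h.isOpen (fun v hv => (hθ v hv).2) hu a
  simp (disch := fun_prop) only [pd_neg, pd_mul, h.pd_eps hu] at h0 h1
  have s0 := h.symm 0
  have s1 := h.symm 1
  simp only [covForm, covVec, Fin.sum_univ_two, h0, h1, (hθ u hu).1, (hθ u hu).2]
  fin_cases a <;> simp only [Fin.zero_eta, Fin.mk_one, s0 1 0 u hu, s1 1 0 u hu] <;>
    constructor <;> ring

end IsUnimodularOn

/-- The projective Einstein-Weyl equation in a coordinate domain. -/
def SolvesPEWIn (O : Set Plane) (Γ : Coeffs) (α : Fin 2 → Plane → ℝ) : Prop :=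
  ∀ u ∈ O, ∀ a b, (covForm Γ α a b u + covForm Γ α b a u) / 2 + α a u * α b u
    + (rhoTensor Γ a b u + rhoTensor Γ b a u) / 2 = 0

/-- The function `F` with `∇_a α_b = -α_a α_b - P_ab + F ε_ab`. -/
def curl (Γ : Coeffs) (ε : Fin 2 → Fin 2 → Plane → ℝ) (α : Fin 2 → Plane → ℝ) (u : Plane) : ℝ :=
  (ε 0 1 u)⁻¹ * (covForm Γ α 0 1 u + α 0 u * α 1 u + rhoTensor Γ 0 1 u)

/-! ### Prolongation of the equation: the scalar `F` and the contractions of `α` with `Y` and `W`.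
-/

namespace IsUnimodularOn

variable {O : Set Plane} {Γ : Coeffs} {ε : Fin 2 → Fin 2 → Plane → ℝ} {α : Fin 2 → Plane → ℝ}

theorem smooth_curl (h : IsUnimodularOn O Γ ε) (hα : ∀ a, ContDiffOn ℝ ∞ (α a) O) :
    ContDiffOn ℝ ∞ (curl Γ ε α) O := by
  have hΓ := h.smooth
  have hr := h.smooth_rhoTensor
  have hp : ∀ a i, ContDiffOn ℝ ∞ (pd a (α i)) O := fun a i => contDiffOn_pd h.isOpen (hα i) a
  have hi : ContDiffOn ℝ ∞ (fun u => (ε 0 1 u)⁻¹) O := (h.smooth_eps 0 1).inv h.ne_zero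
  have : curl Γ ε α = fun u =>
    (ε 0 1 u)⁻¹ * (covForm Γ α 0 1 u + α 0 u * α 1 u + rhoTensor Γ 0 1 u) := rfl
  simp only [this, covForm, Fin.sum_univ_two]
  fun_prop

/-- The equation fixes the symmetric part of `∇α` and `F` names the skew part, so all first
derivatives of `α` are eliminated in favour of `α`, `F` and the geometry. -/
theorem pd_form (h : IsUnimodularOn O Γ ε) (hs : SolvesPEWIn O Γ α) {u : Plane} (hu : u ∈ O) :
    pd 0 (α 0) u = Γ 0 0 0 u * α 0 u + Γ 1 0 0 u * α 1 u - α 0 u * α 0 u - rhoTensor Γ 0 0 u ∧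
    pd 0 (α 1) u = Γ 0 0 1 u * α 0 u + Γ 1 0 1 u * α 1 u - α 0 u * α 1 u - rhoTensor Γ 0 1 u
      + curl Γ ε α u * ε 0 1 u ∧
    pd 1 (α 0) u = Γ 0 0 1 u * α 0 u + Γ 1 0 1 u * α 1 u - α 0 u * α 1 u - rhoTensor Γ 0 1 u
      - curl Γ ε α u * ε 0 1 u ∧
    pd 1 (α 1) u = Γ 0 1 1 u * α 0 u + Γ 1 1 1 u * α 1 u - α 1 u * α 1 u - rhoTensor Γ 1 1 u := by
  have hF : curl Γ ε α u * ε 0 1 u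
      = covForm Γ α 0 1 u + α 0 u * α 1 u + rhoTensor Γ 0 1 u := by
    have := h.ne_zero u hu
    rw [curl]; field_simp
  have h00 := hs u hu 0 0
  have h01 := hs u hu 0 1
  have h11 := hs u hu 1 1
  rw [h.rhoTensor_symm hu 1 0] at h01
  rw [hF]
  simp only [covForm, Fin.sum_univ_two, h.symm _ 1 0 u hu] at h00 h01 h11 ⊢
  refine ⟨?_, ?_, ?_, ?_⟩
  · linear_combination h00
  · ring
  · linear_combination 2 * h01
  · linear_combination h11

/-- This is the Ricci identity for `α`: equality of its mixed second derivatives, once first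
derivatives are replaced by `pd_form`, can be solved for the derivatives of `F`. -/
theorem pd_curl (h : IsUnimodularOn O Γ ε) (hα : ∀ a, ContDiffOn ℝ ∞ (α a) O)
    (hs : SolvesPEWIn O Γ α) {u : Plane} (hu : u ∈ O) (b : Fin 2) :
    pd b (curl Γ ε α) u = -3 * (curl Γ ε α u * α b u) - 1 / 2 * Ylow Γ ε b u := by
  have e0 := pd_comm h.isOpen (hα 0) hu 0 1
  have e1 := pd_comm h.isOpen (hα 1) hu 0 1
  rw [pd_congr h.isOpen (fun v hv => (h.pd_form hs hv).2.2.1) hu,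
    pd_congr h.isOpen (fun v hv => (h.pd_form hs hv).1) hu] at e0
  rw [pd_congr h.isOpen (fun v hv => (h.pd_form hs hv).2.2.2) hu,
    pd_congr h.isOpen (fun v hv => (h.pd_form hs hv).2.1) hu] at e1
  have dΓ := h.differentiableAt hu
  have dε := h.differentiableAt_eps hu
  have dα := fun a => differentiableAt_of_contDiffOn h.isOpen (hα a) hu
  have dP := fun a b => differentiableAt_of_contDiffOn h.isOpen (h.smooth_rhoTensor a b) hu
  have dF := differentiableAt_of_contDiffOn h.isOpen (h.smooth_curl hα) hu
  have hP := pd_congr h.isOpen (fun v hv => h.rhoTensor_symm hv 1 0) hu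
  obtain ⟨p00, p01, p10, p11⟩ := h.pd_form hs hu
  simp (disch := fun_prop) only [pd_add, pd_sub, pd_mul, h.pd_eps hu, p00, p01, p10, p11] at e0 e1
  have h0 := h.ne_zero u hu
  have hY : ∀ a, Ylow Γ ε a u * ε 0 1 u = 2 * cottonYork Γ 0 1 a u := by
    intro a
    rw [h.Ylow_eq]; field_simp
  have hY0 := hY 0
  have hY1 := hY 1
  -- In dimension two the full curvature is determined by `P`, so the curvature terms contracted
  -- with `α` cancel against the `P`-terms.
  obtain ⟨c00, c10⟩ := h.curv_eq hu 0
  obtain ⟨c01, c11⟩ := h.curv_eq hu 1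
  simp only [cottonYork, covTwo, curv, Fin.sum_univ_two, h.symm _ 1 0 u hu, h.pd_symm hu _ _ 1 0,
    h.rhoTensor_symm hu 1 0, hP] at hY0 hY1 c00 c10 c01 c11 e0 e1
  apply mul_right_cancel₀ h0
  fin_cases b <;> simp only [Fin.zero_eta, Fin.mk_one]
  · linear_combination -e0 + hY0 / 2 + α 0 u * c00 + α 1 u * c10
  · linear_combination -e1 + hY1 / 2 + α 0 u * c01 + α 1 u * c11

/-- Integrability of the formula for the gradient of `F`: the curl of `α` contributes `F²`, the
product of the gradient of `F` with `α` contributes `Y^a α_a`, and the curl of `Y_a` contributes the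
divergence `φ / 2`. -/
theorem Yup_contr (h : IsUnimodularOn O Γ ε) (hα : ∀ a, ContDiffOn ℝ ∞ (α a) O)
    (hs : SolvesPEWIn O Γ α) {u : Plane} (hu : u ∈ O) :
    Yup Γ ε 0 u * α 0 u + Yup Γ ε 1 u * α 1 u
      = -4 * (curl Γ ε α u * curl Γ ε α u) - 1 / 6 * phi Γ ε u := by
  have e := pd_comm h.isOpen (h.smooth_curl hα) hu 0 1
  rw [pd_congr h.isOpen (fun v hv => h.pd_curl hα hs hv 1) hu,
    pd_congr h.isOpen (fun v hv => h.pd_curl hα hs hv 0) hu] at e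
  have dα := fun a => differentiableAt_of_contDiffOn h.isOpen (hα a) hu
  have dY := fun a => differentiableAt_of_contDiffOn h.isOpen (h.smooth_Ylow a) hu
  have dF := differentiableAt_of_contDiffOn h.isOpen (h.smooth_curl hα) hu
  obtain ⟨-, p01, p10, -⟩ := h.pd_form hs hu
  simp (disch := fun_prop) only [pd_sub, pd_mul, pd_const, h.pd_curl hα hs hu,
    p01, p10] at e
  have h0 := h.ne_zero u hu
  have k0 := h.covForm_lower h.smooth_Yup (fun v hv => h.Ylow_eq_Yup hv) hu 0
  have k1 := h.covForm_lower h.smooth_Yup (fun v hv => h.Ylow_eq_Yup hv) hu 1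
  have f0 := k0.2
  have f1 := k1.1
  simp only [covForm, Fin.sum_univ_two, h.symm _ 1 0 u hu] at f0 f1
  obtain ⟨y0, y1⟩ := h.Ylow_eq_Yup hu
  apply mul_right_cancel₀ h0
  simp only [phi, Fin.sum_univ_two]
  rw [y0, y1] at e f0 f1
  linear_combination -2 / 3 * e - f0 / 3 + f1 / 3

/-- Differentiation of a relation `V^a α_a = g` along the coordinate with index `b`. -/
theorem pd_contr (h : IsUnimodularOn O Γ ε) (hα : ∀ a, ContDiffOn ℝ ∞ (α a) O)
    (hs : SolvesPEWIn O Γ α) {V : Fin 2 → Plane → ℝ} {g : Plane → ℝ}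
    (hV : ∀ a, ContDiffOn ℝ ∞ (V a) O)
    (hg : ∀ u ∈ O, V 0 u * α 0 u + V 1 u * α 1 u = g u) {u : Plane} (hu : u ∈ O) :
    (pd 0 g u = covVec Γ V 0 0 u * α 0 u + covVec Γ V 0 1 u * α 1 u - α 0 u * g u
      - rhoTensor Γ 0 0 u * V 0 u - rhoTensor Γ 0 1 u * V 1 u
      + curl Γ ε α u * ε 0 1 u * V 1 u) ∧
    (pd 1 g u = covVec Γ V 1 0 u * α 0 u + covVec Γ V 1 1 u * α 1 u - α 1 u * g u
      - rhoTensor Γ 0 1 u * V 0 u - rhoTensor Γ 1 1 u * V 1 u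
      - curl Γ ε α u * ε 0 1 u * V 0 u) := by
  have dα := fun a => differentiableAt_of_contDiffOn h.isOpen (hα a) hu
  have dV := fun a => differentiableAt_of_contDiffOn h.isOpen (hV a) hu
  obtain ⟨p00, p01, p10, p11⟩ := h.pd_form hs hu
  rw [← pd_congr h.isOpen hg hu, ← pd_congr h.isOpen hg hu, ← hg u hu]
  simp (disch := fun_prop) only [pd_add, pd_mul, p00, p01, p10, p11]
  simp only [covVec, Fin.sum_univ_two, h.symm _ 1 0 u hu]
  constructor <;> ring

/-- Differentiating the relation for `Y^a α_a` along `Y` kills the `F ε_ab` term by skewness. The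
correction `-(2φ/3) Y^a` in `W` is what removes the mixed term `φ F²`, and `ℓ / 3` collects
everything free of `F`. -/
theorem Wup_contr (h : IsUnimodularOn O Γ ε) (hα : ∀ a, ContDiffOn ℝ ∞ (α a) O)
    (hs : SolvesPEWIn O Γ α) {u : Plane} (hu : u ∈ O) :
    Wup Γ ε 0 u * α 0 u + Wup Γ ε 1 u * α 1 u
      = -80 * (curl Γ ε α u * curl Γ ε α u * (curl Γ ε α u * curl Γ ε α u))
        + 1 / 3 * ell Γ ε u := by
  have r := h.Yup_contr hα hs hu
  obtain ⟨e0, e1⟩ := h.pd_contr hα hs h.smooth_Yup (fun v hv => h.Yup_contr hα hs hv) hu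
  have dF := differentiableAt_of_contDiffOn h.isOpen (h.smooth_curl hα) hu
  have dφ := differentiableAt_of_contDiffOn h.isOpen h.smooth_phi hu
  obtain ⟨y0, y1⟩ := h.Ylow_eq_Yup hu
  simp (disch := fun_prop) only [pd_sub, pd_mul, pd_const, h.pd_curl hα hs hu, y0, y1] at e0 e1
  simp only [Wup, ell, dY, Fin.sum_univ_two, h.rhoTensor_symm hu 1 0]
  set F := curl Γ ε α u
  linear_combination -Yup Γ ε 0 u * e0 - Yup Γ ε 1 u * e1
    + (20 * (F * F) - 5 / 6 * phi Γ ε u) * r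
end IsUnimodularOn

/-! ### Second-level relations and the common root. -/

namespace IsUnimodularOn

variable {O : Set Plane} {Γ : Coeffs} {ε : Fin 2 → Fin 2 → Plane → ℝ} {α : Fin 2 → Plane → ℝ}

theorem covForm_Ylow (h : IsUnimodularOn O Γ ε) {u : Plane} (hu : u ∈ O) (a : Fin 2) :
    covForm Γ (Ylow Γ ε) a 0 u = -(ε 0 1 u * covVec Γ (Yup Γ ε) a 1 u) ∧
      covForm Γ (Ylow Γ ε) a 1 u = ε 0 1 u * covVec Γ (Yup Γ ε) a 0 u :=
  h.covForm_lower h.smooth_Yup (fun _ hv => h.Ylow_eq_Yup hv) hu a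

theorem covForm_Wlow (h : IsUnimodularOn O Γ ε) {u : Plane} (hu : u ∈ O) (a : Fin 2) :
    covForm Γ (Wlow Γ ε) a 0 u = -(ε 0 1 u * covVec Γ (Wup Γ ε) a 1 u) ∧
      covForm Γ (Wlow Γ ε) a 1 u = ε 0 1 u * covVec Γ (Wup Γ ε) a 0 u :=
  h.covForm_lower h.smooth_Wup (fun v _ => h.Wlow_eq v) hu a

theorem rho_eq (h : IsUnimodularOn O Γ ε) {u : Plane} (hu : u ∈ O) :
    rho Γ ε u = ε 0 1 u * (Yup Γ ε 0 u * Wup Γ ε 1 u - Yup Γ ε 1 u * Wup Γ ε 0 u) := by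
  obtain ⟨y0, y1⟩ := h.Ylow_eq_Yup hu
  simp only [rho, Fin.sum_univ_two, y0, y1]
  ring

theorem pd_rho (h : IsUnimodularOn O Γ ε) {u : Plane} (hu : u ∈ O) (b : Fin 2) :
    pd b (rho Γ ε) u = ε 0 1 u * (covVec Γ (Yup Γ ε) b 0 u * Wup Γ ε 1 u
      + Yup Γ ε 0 u * covVec Γ (Wup Γ ε) b 1 u - covVec Γ (Yup Γ ε) b 1 u * Wup Γ ε 0 u
      - Yup Γ ε 1 u * covVec Γ (Wup Γ ε) b 0 u) := by
  have dY := fun a => differentiableAt_of_contDiffOn h.isOpen (h.smooth_Yup a) hu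
  have dW := fun a => differentiableAt_of_contDiffOn h.isOpen (h.smooth_Wup a) hu
  have dε := h.differentiableAt_eps hu
  rw [pd_congr h.isOpen (fun v hv => h.rho_eq hv) hu]
  simp (disch := fun_prop) only [pd_sub, pd_mul, h.pd_eps hu]
  simp only [covVec, Fin.sum_univ_two]
  ring

/-- The relation for `Y^a α_a`, differentiated along `W`. -/
theorem pd_Yup_contr (h : IsUnimodularOn O Γ ε) (hα : ∀ a, ContDiffOn ℝ ∞ (α a) O)
    (hs : SolvesPEWIn O Γ α) {u : Plane} (hu : u ∈ O) :
    ∑ b, ∑ a, Wup Γ ε b u * covVec Γ (Yup Γ ε) b a u * α a u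
      = (∑ a, Wup Γ ε a u * α a u) * (∑ a, Yup Γ ε a u * α a u)
        + ∑ a, ∑ e, rhoTensor Γ a e u * Wup Γ ε e u * Yup Γ ε a u
        + 24 * curl Γ ε α u ^ 2 * (∑ a, Wup Γ ε a u * α a u)
        + 5 * curl Γ ε α u * rho Γ ε u - dW Γ ε (phi Γ ε) u / 6 := by
  have r := h.Yup_contr hα hs hu
  obtain ⟨e0, e1⟩ := h.pd_contr hα hs h.smooth_Yup (fun v hv => h.Yup_contr hα hs hv) hu
  have dF := differentiableAt_of_contDiffOn h.isOpen (h.smooth_curl hα) hu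
  have dφ := differentiableAt_of_contDiffOn h.isOpen h.smooth_phi hu
  obtain ⟨y0, y1⟩ := h.Ylow_eq_Yup hu
  -- Rewriting by `← r` folds the polynomial in `F` back into `Y^a α_a`, keeping the relation in
  -- terms of contractions.
  simp (disch := fun_prop) only [pd_sub, pd_mul, pd_const, h.pd_curl hα hs hu, y0, y1, ← r] at e0 e1
  simp only [h.rho_eq hu, dW, Fin.sum_univ_two, h.rhoTensor_symm hu 1 0]
  linear_combination -Wup Γ ε 0 u * e0 - Wup Γ ε 1 u * e1

/-- The relation for `W^a α_a`, differentiated along `Y` and along `W`. -/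
theorem pd_Wup_contr (h : IsUnimodularOn O Γ ε) (hα : ∀ a, ContDiffOn ℝ ∞ (α a) O)
    (hs : SolvesPEWIn O Γ α) {u : Plane} (hu : u ∈ O) :
    (∑ b, ∑ a, Yup Γ ε b u * covVec Γ (Wup Γ ε) b a u * α a u
      = (∑ a, Yup Γ ε a u * α a u) * (∑ a, Wup Γ ε a u * α a u)
        + ∑ a, ∑ e, rhoTensor Γ a e u * Wup Γ ε e u * Yup Γ ε a u
        + 960 * curl Γ ε α u ^ 4 * (∑ a, Yup Γ ε a u * α a u)
        - curl Γ ε α u * rho Γ ε u + dY Γ ε (ell Γ ε) u / 3) ∧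
    (∑ b, ∑ a, Wup Γ ε b u * covVec Γ (Wup Γ ε) b a u * α a u
      = (∑ a, Wup Γ ε a u * α a u) ^ 2
        + ∑ e, ∑ a, rhoTensor Γ e a u * Wup Γ ε e u * Wup Γ ε a u
        + 960 * curl Γ ε α u ^ 4 * (∑ a, Wup Γ ε a u * α a u)
        + 160 * curl Γ ε α u ^ 3 * rho Γ ε u + dW Γ ε (ell Γ ε) u / 3) := by
  have r := h.Wup_contr hα hs hu
  obtain ⟨e0, e1⟩ := h.pd_contr hα hs h.smooth_Wup (fun v hv => h.Wup_contr hα hs hv) hu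
  have dF := differentiableAt_of_contDiffOn h.isOpen (h.smooth_curl hα) hu
  have dℓ := differentiableAt_of_contDiffOn h.isOpen h.smooth_ell hu
  obtain ⟨y0, y1⟩ := h.Ylow_eq_Yup hu
  simp (disch := fun_prop) only [pd_add, pd_mul, pd_const, h.pd_curl hα hs hu, y0, y1, ← r]
    at e0 e1
  simp only [h.rho_eq hu, dW, dY, Fin.sum_univ_two, h.rhoTensor_symm hu 1 0]
  constructor
  · linear_combination -Yup Γ ε 0 u * e0 - Yup Γ ε 1 u * e1
  · linear_combination -Wup Γ ε 0 u * e0 - Wup Γ ε 1 u * e1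

/-- A vector contracted with `α`, expressed through `Y^a α_a` and `W^a α_a`. -/
theorem contr_expand (h : IsUnimodularOn O Γ ε) {u : Plane} (hu : u ∈ O) (U : Fin 2 → Plane → ℝ)
    (x : Fin 2 → ℝ) :
    (rho Γ ε u * ∑ b, ∑ a, U b u * covVec Γ (Yup Γ ε) b a u * x a
      = -(∑ a, Wup Γ ε a u * x a) * contr Γ U (Yup Γ ε) (Ylow Γ ε) u
        + (∑ a, Yup Γ ε a u * x a) * contr Γ U (Wup Γ ε) (Ylow Γ ε) u) ∧
    (rho Γ ε u * ∑ b, ∑ a, U b u * covVec Γ (Wup Γ ε) b a u * x a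
      = -(∑ a, Wup Γ ε a u * x a) * contr Γ U (Yup Γ ε) (Wlow Γ ε) u
        + (∑ a, Yup Γ ε a u * x a) * contr Γ U (Wup Γ ε) (Wlow Γ ε) u) := by
  simp only [contr, h.rho_eq hu, Fin.sum_univ_two, h.covForm_Ylow hu, h.covForm_Wlow hu]
  constructor <;> ring

/-- Both follow from the product rule for `ρ = Y_a W^a` and the fact that, in dimension two, the
skew part of the derivative of a lowered field is its divergence times `ε`. They translate between
the contractions in `P₃` and the derivatives of `ρ` in `P₁`. -/
theorem contr_relations (h : IsUnimodularOn O Γ ε) {u : Plane} (hu : u ∈ O) :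
    contr Γ (Yup Γ ε) (Yup Γ ε) (Wlow Γ ε) u - contr Γ (Wup Γ ε) (Yup Γ ε) (Ylow Γ ε) u
      = -dY Γ ε (rho Γ ε) u + phi Γ ε u * rho Γ ε u / 2 ∧
    contr Γ (Yup Γ ε) (Wup Γ ε) (Wlow Γ ε) u - contr Γ (Wup Γ ε) (Wup Γ ε) (Ylow Γ ε) u
      = divW Γ ε u * rho Γ ε u - dW Γ ε (rho Γ ε) u := by
  simp only [contr, h.rho_eq hu, dY, dW, divW, phi, h.pd_rho hu, Fin.sum_univ_two,
    h.covForm_Ylow hu, h.covForm_Wlow hu]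
  constructor <;> ring

open Polynomial in
theorem eval_eq_zero (h : IsUnimodularOn O Γ ε) (hα : ∀ a, ContDiffOn ℝ ∞ (α a) O)
    (hs : SolvesPEWIn O Γ α) {u : Plane} (hu : u ∈ O) (hρ : rho Γ ε u ≠ 0) :
    (P₁ Γ ε u).eval (2 * curl Γ ε α u) = 0 ∧ (P₂ Γ ε u).eval (2 * curl Γ ε α u) = 0 ∧
      (P₃ Γ ε u).eval (2 * curl Γ ε α u) = 0 := by
  have hY := h.Yup_contr hα hs hu
  have hW := h.Wup_contr hα hs hu
  have E1 := h.pd_Yup_contr hα hs hu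
  obtain ⟨E2, E3⟩ := h.pd_Wup_contr hα hs hu
  have x1 := (h.contr_expand hu (Wup Γ ε) (fun a => α a u)).1
  have x2 := (h.contr_expand hu (Yup Γ ε) (fun a => α a u)).2
  have x3 := (h.contr_expand hu (Wup Γ ε) (fun a => α a u)).2
  obtain ⟨r1, r2⟩ := h.contr_relations hu
  rw [E1] at x1
  rw [E2] at x2
  rw [E3] at x3
  clear E1 E2 E3
  have hY' : ∑ a, Yup Γ ε a u * α a u = _ := (Fin.sum_univ_two _).trans hY
  have hW' : ∑ a, Wup Γ ε a u * α a u = _ := (Fin.sum_univ_two _).trans hW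
  rw [hY', hW'] at x1 x2 x3
  clear hY' hW' hY hW
  -- Each coefficient is multiplied by `ρ`, so that the final identities are free of denominators.
  have ha₁ : a₁ Γ ε u * rho Γ ε u = 15 * dY Γ ε (rho Γ ε) u - 75 / 2 * phi Γ ε u * rho Γ ε u := by
    rw [a₁]; field_simp; ring
  have ha₂ : a₂ Γ ε u * rho Γ ε u = -3 * dW Γ ε (rho Γ ε) u - 6 * ell Γ ε u * rho Γ ε u
      + 3 * divW Γ ε u * rho Γ ε u := by
    rw [a₂]; field_simp; ring
  have ha₃ : a₃ Γ ε u * rho Γ ε u = (dW Γ ε (phi Γ ε) u / 2 + phi Γ ε u / 2 * divW Γ ε u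
      + dY Γ ε (ell Γ ε) u + phi Γ ε u * ell Γ ε u / 2) * rho Γ ε u
      - phi Γ ε u * dW Γ ε (rho Γ ε) u / 2 - ell Γ ε u * dY Γ ε (rho Γ ε) u := by
    rw [a₃]; field_simp
  have hb₁ : b₁ Γ ε u * rho Γ ε u = -5 * contr Γ (Wup Γ ε) (Yup Γ ε) (Wlow Γ ε) u
      + 50 / 3 * ell Γ ε u * rho Γ ε u := by
    rw [b₁]; field_simp
  have hb₂ : b₂ Γ ε u * rho Γ ε u = contr Γ (Wup Γ ε) (Wup Γ ε) (Wlow Γ ε) u := by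
    rw [b₂]; field_simp
  have hb₃ : b₃ Γ ε u * rho Γ ε u
      = phi Γ ε u * contr Γ (Wup Γ ε) (Wup Γ ε) (Wlow Γ ε) u / 6
      + (∑ e, ∑ a, rhoTensor Γ e a u * Wup Γ ε e u * Wup Γ ε a u) * rho Γ ε u
      + ell Γ ε u ^ 2 / 9 * rho Γ ε u
      + ell Γ ε u * contr Γ (Wup Γ ε) (Yup Γ ε) (Wlow Γ ε) u / 3
      + dW Γ ε (ell Γ ε) u / 3 * rho Γ ε u := by
    rw [b₃]; field_simp
  have hc₁ : c₁ Γ ε u * rho Γ ε u = -5 / 2 * (contr Γ (Wup Γ ε) (Yup Γ ε) (Ylow Γ ε) u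
      + contr Γ (Yup Γ ε) (Yup Γ ε) (Wlow Γ ε) u) - 25 / 6 * phi Γ ε u * rho Γ ε u := by
    rw [c₁]; field_simp
  have hc₂ : c₂ Γ ε u * rho Γ ε u = 2 / 3 * ell Γ ε u * rho Γ ε u
      + (contr Γ (Wup Γ ε) (Wup Γ ε) (Ylow Γ ε) u
        + contr Γ (Yup Γ ε) (Wup Γ ε) (Wlow Γ ε) u) / 2 := by
    rw [c₂]; field_simp
  have hc₃ : c₃ Γ ε u * rho Γ ε u = (-dW Γ ε (phi Γ ε) u / 12
      + ∑ a, ∑ e, rhoTensor Γ a e u * Wup Γ ε e u * Yup Γ ε a u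
      + dY Γ ε (ell Γ ε) u / 6 - ell Γ ε u * phi Γ ε u / 18) * rho Γ ε u
      + phi Γ ε u * (contr Γ (Wup Γ ε) (Wup Γ ε) (Ylow Γ ε) u
        + contr Γ (Yup Γ ε) (Wup Γ ε) (Wlow Γ ε) u) / 12
      + ell Γ ε u * (contr Γ (Wup Γ ε) (Yup Γ ε) (Ylow Γ ε) u
        + contr Γ (Yup Γ ε) (Yup Γ ε) (Wlow Γ ε) u) / 6 := by
    rw [c₃]; field_simp; ring
  simp only [P₁, P₂, P₃, eval_add, eval_mul, eval_C, eval_pow, eval_X]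
  set F := curl Γ ε α u
  refine ⟨mul_right_cancel₀ hρ ?_, mul_right_cancel₀ hρ ?_, mul_right_cancel₀ hρ ?_⟩
  -- `P₁` is three times the difference of the two mixed relations, in which the quadratic and `P(W,
  -- Y)` terms cancel. `P₂` is the relation along `W` twice, and `P₃` is half the sum of the mixed
  -- ones. The multipliers of `r1` and `r2` are `-3 W^a α_a` and `3 Y^a α_a`.
  · linear_combination (2 * F) ^ 4 * ha₁ + (2 * F) ^ 2 * ha₂ + ha₃ + 3 * x2 - 3 * x1
      + (240 * F ^ 4 - ell Γ ε u) * r1 - (12 * F ^ 2 + phi Γ ε u / 2) * r2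
  · linear_combination (2 * F) ^ 4 * hb₁ + (2 * F) ^ 2 * hb₂ + hb₃ + x3
  · linear_combination (2 * F) ^ 4 * hc₁ + (2 * F) ^ 2 * hc₂ + hc₃ + x1 / 2 + x2 / 2

end IsUnimodularOn

/-! ### Resultants and Sylvester determinants of polynomials with a common root -/

-- At a common root a Bézout identity would read `0 = 1`. The case of two zero polynomials must be
-- excluded, since its empty Sylvester determinant is `1`.
open Polynomial in
theorem resultant_eq_zero_of_common_root {f g : ℝ[X]} (hf : f ≠ 0) {t : ℝ} (h1 : f.eval t = 0)
    (h2 : g.eval t = 0) : resultant f g = 0 := by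
  rw [resultant_eq_zero_iff]
  refine ⟨Or.inl hf, ?_⟩
  rintro ⟨a, b, hab⟩
  have := congrArg (eval t) hab
  simp [h1, h2] at this

/-- The vector of descending powers of the common root lies in the kernel, each row producing a
power of `x` times one of the two polynomials. It is nonzero because its last entry is `1`. -/
theorem sylvester43_det_eq_zero {p : Fin 5 → ℝ} {q : Fin 4 → ℝ} {x : ℝ}
    (hp : ∑ i, p i * x ^ (4 - (i : ℕ)) = 0) (hq : ∑ i, q i * x ^ (3 - (i : ℕ)) = 0) :
    (sylvester43 p q).det = 0 := by
  rw [← Matrix.exists_mulVec_eq_zero_iff]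
  refine ⟨![x ^ 6, x ^ 5, x ^ 4, x ^ 3, x ^ 2, x, 1], fun h => one_ne_zero (congrFun h 6), ?_⟩
  simp [Fin.sum_univ_five, Fin.sum_univ_four] at hp hq
  ext i
  fin_cases i <;> simp [sylvester43, Matrix.mulVec, dotProduct, Fin.sum_univ_succ]
  · linear_combination x ^ 2 * hp
  · linear_combination x * hp
  · linear_combination hp
  · linear_combination x ^ 3 * hq
  · linear_combination x ^ 2 * hq
  · linear_combination x * hq
  · linear_combination hq

theorem sylvester34_det_eq_zero {p : Fin 4 → ℝ} {q : Fin 5 → ℝ} {x : ℝ}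
    (hp : ∑ i, p i * x ^ (3 - (i : ℕ)) = 0) (hq : ∑ i, q i * x ^ (4 - (i : ℕ)) = 0) :
    (sylvester34 p q).det = 0 := by
  rw [← Matrix.exists_mulVec_eq_zero_iff]
  refine ⟨![x ^ 6, x ^ 5, x ^ 4, x ^ 3, x ^ 2, x, 1], fun h => one_ne_zero (congrFun h 6), ?_⟩
  simp [Fin.sum_univ_five, Fin.sum_univ_four] at hp hq
  ext i
  fin_cases i <;> simp [sylvester34, Matrix.mulVec, dotProduct, Fin.sum_univ_succ]
  · linear_combination x ^ 3 * hp
  · linear_combination x ^ 2 * hp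
  · linear_combination x * hp
  · linear_combination hp
  · linear_combination x ^ 2 * hq
  · linear_combination x * hq
  · linear_combination hq

theorem sylvester44_det_eq_zero {p q : Fin 5 → ℝ} {x : ℝ}
    (hp : ∑ i, p i * x ^ (4 - (i : ℕ)) = 0) (hq : ∑ i, q i * x ^ (4 - (i : ℕ)) = 0) :
    (sylvester44 p q).det = 0 := by
  rw [← Matrix.exists_mulVec_eq_zero_iff]
  refine ⟨![x ^ 7, x ^ 6, x ^ 5, x ^ 4, x ^ 3, x ^ 2, x, 1],
    fun h => one_ne_zero (congrFun h 7), ?_⟩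
  simp [Fin.sum_univ_five] at hp hq
  ext i
  fin_cases i <;> simp [sylvester44, Matrix.mulVec, dotProduct, Fin.sum_univ_succ]
  · linear_combination x ^ 3 * hp
  · linear_combination x ^ 2 * hp
  · linear_combination x * hp
  · linear_combination hp
  · linear_combination x ^ 3 * hq
  · linear_combination x ^ 2 * hq
  · linear_combination x * hq
  · linear_combination hq

/-! ### Elimination of the odd powers of `t`. -/

section Polynomials

open Polynomial

variable (Γ : Coeffs) (ε : Fin 2 → Fin 2 → Plane → ℝ) (u : Plane)

theorem P₁_ne_zero : P₁ Γ ε u ≠ 0 := by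
  intro h
  have := congrArg (fun f => coeff f 6) h
  simp [P₁] at this

theorem P₂_ne_zero : P₂ Γ ε u ≠ 0 := by
  intro h
  have := congrArg (fun f => coeff f 8) h
  simp [P₂, mul_assoc, coeff_X_pow] at this

/-- The only odd terms are multiples of `ρ t` in `P₁`, `P₃` and `ρ t³` in `P₂`. The multipliers here
and in the next two identities are those that cancel them. -/
theorem Q₁_comp : (Q₁ Γ ε u).comp (X ^ 2) = -20 * X ^ 2 * P₃ Γ ε u + P₂ Γ ε u := by
  refine Polynomial.funext fun x => ?_
  simp [Q₁, q₁, P₃, P₂, Fin.sum_univ_five]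
  ring

theorem Q₂_comp : (Q₂ Γ ε u).comp (X ^ 2) = -9 * P₃ Γ ε u - P₁ Γ ε u := by
  refine Polynomial.funext fun x => ?_
  simp [Q₂, q₂, P₃, P₁, Fin.sum_univ_four]
  ring

theorem Q₃_comp :
    (Q₃ Γ ε u).comp (X ^ 2) = -C (20 / 9) * X ^ 2 * P₁ Γ ε u - P₂ Γ ε u := by
  refine Polynomial.funext fun x => ?_
  simp [Q₃, q₃, P₂, P₁, Fin.sum_univ_five]
  ring

theorem conclusion_of_common_root {t : ℝ} (h1 : (P₁ Γ ε u).eval t = 0)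
    (h2 : (P₂ Γ ε u).eval t = 0) (h3 : (P₃ Γ ε u).eval t = 0) :
    (resultant (P₁ Γ ε u) (P₂ Γ ε u) = 0 ∧ resultant (P₂ Γ ε u) (P₃ Γ ε u) = 0 ∧
      resultant (P₁ Γ ε u) (P₃ Γ ε u) = 0) ∧
    ((sylvester43 (q₁ Γ ε u) (q₂ Γ ε u)).det = 0 ∧
      (sylvester34 (q₂ Γ ε u) (q₃ Γ ε u)).det = 0 ∧
      (sylvester44 (q₁ Γ ε u) (q₃ Γ ε u)).det = 0) := by
  have k1 := congrArg (eval t) (Q₁_comp Γ ε u)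
  have k2 := congrArg (eval t) (Q₂_comp Γ ε u)
  have k3 := congrArg (eval t) (Q₃_comp Γ ε u)
  simp only [eval_add, eval_sub, eval_mul, h1, h2, h3, mul_zero, add_zero, sub_zero,
    eval_comp, eval_pow, eval_X, Q₁, Q₂, Q₃, eval_finsetSum, eval_C] at k1 k2 k3
  exact ⟨⟨resultant_eq_zero_of_common_root (P₁_ne_zero Γ ε u) h1 h2,
    resultant_eq_zero_of_common_root (P₂_ne_zero Γ ε u) h2 h3,
    resultant_eq_zero_of_common_root (P₁_ne_zero Γ ε u) h1 h3⟩,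
    sylvester43_det_eq_zero k1 k2, sylvester34_det_eq_zero k2 k3, sylvester44_det_eq_zero k1 k3⟩

end Polynomials

/-- Projective invariance of the projective Einstein-Weyl equation. -/
theorem SolvesPEWIn.of_projective_change {O : Set Plane} (hO : IsOpen O) {Γ Γ' : Coeffs}
    {Υ α : Fin 2 → Plane → ℝ} (hΓ : ∀ k i j, ContDiffOn ℝ ∞ (Γ k i j) O)
    (hΓs : ∀ k i j, ∀ u ∈ O, Γ k i j u = Γ k j i u) (hΥ : ∀ i, ContDiffOn ℝ ∞ (Υ i) O)
    (hα : ∀ i, ContDiffOn ℝ ∞ (α i) O)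
    (hΓ' : ∀ k i j, ∀ u ∈ O, Γ' k i j u
      = Γ k i j u + (if k = j then Υ i u else 0) + (if k = i then Υ j u else 0))
    (hs : SolvesPEWIn O Γ' α) : SolvesPEWIn O Γ (fun i u => α i u - Υ i u) := by
  -- The change subtracts `2 Υ_(a α_b)` from the derivative of `α` and adds `-∇_(a Υ_b) + Υ_a Υ_b`
  -- to `P_(ab)`, which completes the square in `α - Υ`. By symmetry in `a`, `b` three components
  -- suffice.
  have main : ∀ u ∈ O, ∀ a b, a ≤ b →
      (covForm Γ (fun i u => α i u - Υ i u) a b u + covForm Γ (fun i u => α i u - Υ i u) b a u) / 2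
      + (α a u - Υ a u) * (α b u - Υ b u) + (rhoTensor Γ a b u + rhoTensor Γ b a u) / 2 = 0 := by
    intro u hu a b hab
    have dΓ := fun k i j => differentiableAt_of_contDiffOn hO (hΓ k i j) hu
    have dα := fun i => differentiableAt_of_contDiffOn hO (hα i) hu
    have dΥ := fun i => differentiableAt_of_contDiffOn hO (hΥ i) hu
    have pΓ := fun c k i j => pd_congr hO (hΓs k i j) hu c
    have pd' : ∀ c k i j, pd c (Γ' k i j) u = pd c (Γ k i j) u
        + (if k = j then pd c (Υ i) u else 0) + (if k = i then pd c (Υ j) u else 0) := by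
      intro c k i j
      rw [pd_congr hO (hΓ' k i j) hu]
      split_ifs <;> simp (disch := fun_prop) [pd_add]
    have e := hs u hu a b
    simp only [covForm, rhoTensor, ricci, curv, Fin.sum_univ_two, pd', hΓ' _ _ _ u hu] at e ⊢
    simp (disch := fun_prop) only [pd_sub]
    fin_cases a <;> fin_cases b
    · simp [hΓs _ 1 0 u hu, pΓ _ _ 1 0] at e ⊢
      linear_combination e
    · simp [hΓs _ 1 0 u hu, pΓ _ _ 1 0] at e ⊢
      linear_combination e
    · simp at hab
    · simp [hΓs _ 1 0 u hu] at e ⊢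
      linear_combination e
  intro u hu a b
  rcases le_total a b with hab | hab
  · exact main u hu a b hab
  · linear_combination main u hu b a hab

/-! ### Coordinate fields of a chart. -/

section Surface

variable {M : Type*} [TopologicalSpace M] [ChartedSpace Plane M]

theorem mdifferentiable_chart {e : OpenPartialHomeomorph M Plane} (he : e ∈ charts M) :
    e.MDifferentiable (𝓡 2) (𝓡 2) :=
  ⟨(contMDiffOn_of_mem_maximalAtlas he).mdifferentiableOn (by simp),
    (contMDiffOn_symm_of_mem_maximalAtlas he).mdifferentiableOn (by simp)⟩

theorem isInvertible_mfderiv_chart {e : OpenPartialHomeomorph M Plane} (he : e ∈ charts M) {x : M}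
    (hx : x ∈ e.source) : (mfderiv (𝓡 2) (𝓡 2) e x).IsInvertible :=
  ⟨(mdifferentiable_chart he).mfderiv hx, rfl⟩

theorem isInvertible_mfderiv_chart_symm {e : OpenPartialHomeomorph M Plane} (he : e ∈ charts M)
    {u : Plane} (hu : u ∈ e.target) : (mfderiv (𝓡 2) (𝓡 2) e.symm u).IsInvertible :=
  ⟨(mdifferentiable_chart he).symm.mfderiv (x := u) hu, rfl⟩

theorem inverse_mfderiv_chart_symm {e : OpenPartialHomeomorph M Plane} (he : e ∈ charts M)
    {u : Plane} (hu : u ∈ e.target) (v : TangentSpace (𝓡 2) (e.symm u)) :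
    (mfderiv (𝓡 2) (𝓡 2) e.symm u).inverse v
      = (show Plane from mfderiv (𝓡 2) (𝓡 2) e (e.symm u) v) := by
  refine (isInvertible_mfderiv_chart_symm he hu).inverse_apply_eq.2 ?_
  have := (mdifferentiable_chart he).symm_comp_deriv (e.map_target hu)
  rw [e.right_inv hu] at this
  exact (congrArg (fun L => L v) this).symm

theorem mfderiv_coordField {e : OpenPartialHomeomorph M Plane} (he : e ∈ charts M) {x : M}
    (hx : x ∈ e.source) (i : Fin 2) :
    mfderiv (𝓡 2) (𝓡 2) e x (coordField e i x) = (EuclideanSpace.single i (1 : ℝ) : Plane) :=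
  (isInvertible_mfderiv_chart he hx).self_apply_inverse _

theorem comp_coordField {e : OpenPartialHomeomorph M Plane} (he : e ∈ charts M) {x : M}
    (hx : x ∈ e.source) (k i : Fin 2) :
    comp e k (coordField e i x) = if k = i then 1 else 0 := by
  rw [comp, mfderiv_coordField he hx]
  simp

/-- As pullbacks of constant fields, the coordinate fields inherit smoothness and vanishing brackets
from the plane. -/
theorem coordField_eq_mpullback (e : OpenPartialHomeomorph M Plane) (i : Fin 2) :
    coordField e i = VectorField.mpullback (𝓡 2) (𝓡 2) e
      (fun _ => (EuclideanSpace.single i (1 : ℝ) : Plane)) := rfl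

theorem contMDiffAt_constField (v u : Plane) :
    ContMDiffAt (𝓡 2) (𝓡 2).tangent ∞
      (fun y : Plane => (⟨y, v⟩ : TangentBundle (𝓡 2) Plane)) u :=
  contMDiffAt_vectorSpace_iff_contDiffAt.2 contDiffAt_const

theorem contMDiffAt_coordField [IsManifold (𝓡 2) ∞ M]
    {e : OpenPartialHomeomorph M Plane} (he : e ∈ charts M) {x : M}
    (hx : x ∈ e.source) (i : Fin 2) :
    ContMDiffAt (𝓡 2) (𝓡 2).tangent ∞
      (fun y => (⟨y, coordField e i y⟩ : TangentBundle (𝓡 2) M)) x := by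
  rw [coordField_eq_mpullback]
  exact ContMDiffAt.mpullback_vectorField_preimage (n := ∞) (contMDiffAt_constField _ _)
    (contMDiffAt_of_mem_maximalAtlas he hx) (isInvertible_mfderiv_chart he hx) (by simp)

theorem mlieBracket_eq_zero_of_const {v w : Plane} {V W : Π x : Plane, TangentSpace (𝓡 2) x}
    (hV : ∀ x, V x = v) (hW : ∀ x, W x = w) (u : Plane) :
    VectorField.mlieBracket (𝓡 2) V W u = 0 := by
  rw [← VectorField.mlieBracketWithin_univ, VectorField.mlieBracketWithin_eq_lieBracketWithin]
  obtain rfl : V = fun _ => v := funext hV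
  obtain rfl : W = fun _ => w := funext hW
  have h : VectorField.lieBracketWithin ℝ (fun _ : Plane => v) (fun _ => w) Set.univ u = 0 := by
    simp [VectorField.lieBracketWithin]
  exact h

theorem mlieBracket_coordField [IsManifold (𝓡 2) ∞ M]
    {e : OpenPartialHomeomorph M Plane} (he : e ∈ charts M) {x : M}
    (hx : x ∈ e.source) (i j : Fin 2) :
    VectorField.mlieBracket (𝓡 2) (coordField e i) (coordField e j) x = 0 := by
  have : IsManifold (𝓡 2) (minSmoothness ℝ 2) M := by
    rw [minSmoothness_of_isRCLikeNormedField]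
    infer_instance
  have : IsManifold (𝓡 2) (minSmoothness ℝ 2) Plane := by
    rw [minSmoothness_of_isRCLikeNormedField]
    infer_instance
  rw [coordField_eq_mpullback, coordField_eq_mpullback]
  have hc : ∀ v : Plane, MDifferentiableAt (𝓡 2) (𝓡 2).tangent
      (fun y : Plane => (⟨y, v⟩ : TangentBundle (𝓡 2) Plane)) (e x) := fun v =>
    (contMDiffAt_constField v (e x)).mdifferentiableAt (by simp)
  rw [← VectorField.mpullback_mlieBracket (n := ∞) (hc _) (hc _)
    (contMDiffAt_of_mem_maximalAtlas he hx)
    (by rw [minSmoothness_of_isRCLikeNormedField]; exact WithTop.coe_le_coe.2 le_top)]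
  rw [VectorField.mpullback_apply, mlieBracket_eq_zero_of_const (fun _ => rfl) (fun _ => rfl),
    map_zero]

end Surface

/-! ### Smoothness and symmetry of the connection coefficients. -/

section Surface

theorem isOpen_chartDomain {M : Type*} [TopologicalSpace M]
    (e : OpenPartialHomeomorph M Plane) {U : Set M} (hU : IsOpen U) :
    IsOpen (chartDomain e U) :=
  e.isOpen_inter_preimage_symm hU

variable {M : Type*} [TopologicalSpace M] [ChartedSpace Plane M]

theorem contDiffAt_coord {F : Plane → Plane} {u : Plane} (hF : ContDiffAt ℝ ∞ F u) (k : Fin 2) :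
    ContDiffAt ℝ ∞ (fun v => F v k) u := by
  fun_prop

/-- The components in a chart of a smooth vector field are smooth. -/
theorem contDiffAt_comp {e : OpenPartialHomeomorph M Plane} [IsManifold (𝓡 2) ∞ M]
    (he : e ∈ charts M) {Z : Π x : M, TangentSpace (𝓡 2) x} {u : Plane} (hu : u ∈ e.target)
    (hZ : ContMDiffAt (𝓡 2) (𝓡 2).tangent ∞
      (fun y => (⟨y, Z y⟩ : TangentBundle (𝓡 2) M)) (e.symm u)) (k : Fin 2) :
    ContDiffAt ℝ ∞ (fun v => comp e k (Z (e.symm v))) u := by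
  have h1 : ContMDiffAt (𝓡 2) (𝓡 2).tangent ∞ (fun v : Plane =>
      (⟨v, VectorField.mpullback (𝓡 2) (𝓡 2) e.symm Z v⟩ : TangentBundle (𝓡 2) Plane)) u :=
    ContMDiffAt.mpullback_vectorField_preimage (n := ∞) hZ
      (contMDiffAt_symm_of_mem_maximalAtlas he hu) (isInvertible_mfderiv_chart_symm he hu)
      (by simp)
  have h2 : ContDiffAt ℝ ∞
      (show Plane → Plane from VectorField.mpullback (𝓡 2) (𝓡 2) e.symm Z) u :=
    contMDiffAt_vectorSpace_iff_contDiffAt.1 h1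
  refine (contDiffAt_coord h2 k).congr_of_eventuallyEq ?_
  filter_upwards [e.open_target.mem_nhds hu] with v hv
  exact congrArg (fun w : Plane => w k) (inverse_mfderiv_chart_symm he hv _).symm

/-- A smooth connection sends coordinate fields to smooth endomorphism fields. -/
theorem contMDiffAt_connection_coordField [T2Space M] [IsManifold (𝓡 2) ∞ M]
    {U : Set M} (hU : IsOpen U) {D : AffineConnection M}
    (hD : ContMDiffCovariantDerivativeOn Plane ∞ D.toFun U) {e : OpenPartialHomeomorph M Plane}
    (he : e ∈ charts M) {x : M} (hx : x ∈ e.source) (hxU : x ∈ U) (j : Fin 2) :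
    ContMDiffAt (𝓡 2) ((𝓡 2).prod 𝓘(ℝ, Plane →L[ℝ] Plane)) ∞
      (fun y => (⟨y, D (coordField e j) y⟩ : TotalSpace (Plane →L[ℝ] Plane)
        fun y : M => TangentSpace (𝓡 2) y →L[ℝ] TangentSpace (𝓡 2) y)) x := by
  -- The coordinate field is controlled only on the chart source, while smoothness of `D` is tested
  -- on fields smooth on all of `U`. A bump function supported in the source gives a global smooth
  -- field with the same germ at `x`.
  obtain ⟨ψ, -, hψ⟩ := (SmoothBumpFunction.nhds_basis_tsupport (I := 𝓡 2) x).mem_iff.1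
    (e.open_source.mem_nhds hx)
  have hs : ContMDiff (𝓡 2) (𝓡 2).tangent ∞
      (fun y => (⟨y, ((ψ : M → ℝ) • coordField e j) y⟩ : TangentBundle (𝓡 2) M)) :=
    ContMDiffOn.smul_section_of_tsupport (u := e.source) ψ.contMDiff.contMDiffOn e.open_source hψ
      fun y hy => (contMDiffAt_coordField he hy j).contMDiffWithinAt
  have h1 := (hD.contMDiff (σ := (ψ : M → ℝ) • coordField e j)
    (hs.contMDiffOn)).contMDiffAt (hU.mem_nhds hxU)
  refine h1.congr_of_eventuallyEq ?_
  -- Locality of `D` at a nearby `y` needs the two fields to agree on a neighbourhood of `y`, not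
  -- only at `y`.
  have hev := ψ.eventuallyEq_one.eventually_nhds
  filter_upwards [hev, e.open_source.mem_nhds hx] with y hy hye
  have : D (coordField e j) y = D ((ψ : M → ℝ) • coordField e j) y := by
    refine (D.isCovariantDerivativeOn (s := Set.univ)).congr_of_eventuallyEq
      ((contMDiffAt_coordField he hye j).mdifferentiableAt (by simp))
      (hs.contMDiffAt.mdifferentiableAt (by simp)) Filter.univ_mem ?_
    filter_upwards [hy] with z hz
    simp [hz]
  exact congrArg _ this

theorem contDiffOn_coeffs [T2Space M] [IsManifold (𝓡 2) ∞ M]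
    {U : Set M} (hU : IsOpen U) {D : AffineConnection M}
    (hD : ContMDiffCovariantDerivativeOn Plane ∞ D.toFun U) {e : OpenPartialHomeomorph M Plane}
    (he : e ∈ charts M) (k i j : Fin 2) :
    ContDiffOn ℝ ∞ (coeffs D e k i j) (chartDomain e U) := by
  intro u hu
  have hx := e.map_target hu.1
  exact (contDiffAt_comp he hu.1 (ContMDiffAt.clm_bundle_apply
    (contMDiffAt_connection_coordField hU hD he hx hu.2 j)
    (contMDiffAt_coordField he hx i)) k).contDiffWithinAt

/-- Coordinate fields commute, so their torsion is exactly the difference of the two covariant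
derivatives. -/
theorem coeffs_symm [IsManifold (𝓡 2) ∞ M]
    {U : Set M} {D : AffineConnection M} (hD : IsTorsionFreeConnectionOn U D)
    {e : OpenPartialHomeomorph M Plane} (he : e ∈ charts M) (k i j : Fin 2) {u : Plane}
    (hu : u ∈ chartDomain e U) : coeffs D e k i j u = coeffs D e k j i u := by
  have hx := e.map_target hu.1
  have h1 := D.torsion_apply ((contMDiffAt_coordField he hx i).mdifferentiableAt (by simp))
    ((contMDiffAt_coordField he hx j).mdifferentiableAt (by simp))
  rw [hD.torsion_eq_zero _ hu.2, mlieBracket_coordField he hx, sub_zero] at h1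
  have h2 := sub_eq_zero.1 h1.symm
  simp only [coeffs, h2]

end Surface

/-- Projective equivalence of connection coefficients in a coordinate domain. -/
def ProjEquivIn (O : Set Plane) (Γ Γ' : Coeffs) : Prop :=
  ∃ Υ : Fin 2 → Plane → ℝ, (∀ i, ContDiffOn ℝ ∞ (Υ i) O) ∧ ∀ k i j, ∀ u ∈ O,
    Γ' k i j u = Γ k i j u + (if k = j then Υ i u else 0) + (if k = i then Υ j u else 0)

theorem ProjEquivIn.symm {O : Set Plane} {Γ Γ' : Coeffs} (h : ProjEquivIn O Γ Γ') :
    ProjEquivIn O Γ' Γ := by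
  obtain ⟨Υ, hΥ, h⟩ := h
  refine ⟨fun i u => -Υ i u, fun i => (hΥ i).neg, fun k i j u hu => ?_⟩
  rw [h k i j u hu]
  split_ifs <;> ring

theorem ProjEquivIn.trans {O : Set Plane} {Γ Γ' Γ'' : Coeffs} (h : ProjEquivIn O Γ Γ')
    (h' : ProjEquivIn O Γ' Γ'') : ProjEquivIn O Γ Γ'' := by
  obtain ⟨Υ, hΥ, h⟩ := h
  obtain ⟨Υ', hΥ', h'⟩ := h'
  refine ⟨fun i u => Υ i u + Υ' i u, fun i => (hΥ i).add (hΥ' i), fun k i j u hu => ?_⟩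
  rw [h' k i j u hu, h k i j u hu]
  split_ifs <;> ring

theorem ProjEquivIn.mono {O O' : Set Plane} {Γ Γ' : Coeffs} (h : ProjEquivIn O Γ Γ')
    (hO : O' ⊆ O) : ProjEquivIn O' Γ Γ' := by
  obtain ⟨Υ, hΥ, h⟩ := h
  exact ⟨Υ, fun i => (hΥ i).mono hO, fun k i j u hu => h k i j u (hO hu)⟩

/-- For a skew-symmetric Ricci tensor, the zero one-form solves the projective Einstein-Weyl
equation. -/
theorem solvesPEWIn_zero {O : Set Plane} {Γ : Coeffs}
    (h : ∀ u ∈ O, ∀ a b, ricci Γ a b u = -ricci Γ b a u) : SolvesPEWIn O Γ (fun _ _ => 0) := by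
  intro u hu a b
  simp only [covForm, pd_const, rhoTensor, mul_zero, Finset.sum_const_zero]
  linear_combination (1 / 2) * h u hu a b

/-! ### Passage from the surface to a chart. -/

section Surface

variable {M : Type*} [TopologicalSpace M] [ChartedSpace Plane M]

theorem comp_add_smul_add_smul (e : OpenPartialHomeomorph M Plane) (k : Fin 2) {x : M}
    (v w z : TangentSpace (𝓡 2) x) (a b : ℝ) :
    comp e k (v + a • w + b • z) = comp e k v + a * comp e k w + b * comp e k z := by
  have h : mfderiv (𝓡 2) (𝓡 2) e x (v + a • w + b • z)
      = mfderiv (𝓡 2) (𝓡 2) e x v + a • mfderiv (𝓡 2) (𝓡 2) e x w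
        + b • mfderiv (𝓡 2) (𝓡 2) e x z := by
    simp only [map_add, map_smul]
  exact congrArg (fun y : Plane => y k) h

theorem ProjectivelyEquivalentOn.projEquivIn [IsManifold (𝓡 2) ∞ M] {U : Set M}
    {D D' : AffineConnection M} (h : ProjectivelyEquivalentOn U D D')
    {e : OpenPartialHomeomorph M Plane} (he : e ∈ charts M) :
    ProjEquivIn (chartDomain e U) (coeffs D e) (coeffs D' e) := by
  obtain ⟨Υ, hΥ, h⟩ := h
  refine ⟨formComp Υ e, hΥ e he, fun k i j u hu => ?_⟩
  have hx := e.map_target hu.1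
  simp only [coeffs]
  rw [h _ hu.2 _ ((contMDiffAt_coordField he hx j).mdifferentiableAt (by simp)),
    comp_add_smul_add_smul, comp_coordField he hx, comp_coordField he hx]
  simp [formComp]

theorem ProjectiveStructure.MemOn.projEquivIn [IsManifold (𝓡 2) ∞ M] {p : ProjectiveStructure M}
    {U : Set M} {D D' : AffineConnection M} (hD : p.MemOn U D) (hD' : p.MemOn U D')
    {e : OpenPartialHomeomorph M Plane} (he : e ∈ charts M) :
    ProjEquivIn (chartDomain e U) (coeffs D e) (coeffs D' e) := by
  obtain ⟨-, D₁, h₁, hD₁⟩ := hD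
  obtain ⟨-, D₂, h₂, hD₂⟩ := hD'
  obtain ⟨D₀, -, hc⟩ := p.isClass
  rw [hc] at h₁ h₂
  have hsub : chartDomain e U ⊆ chartDomain e Set.univ := fun u hu => ⟨hu.1, trivial⟩
  have k₁ := (h₁.2.projEquivIn he).mono hsub
  have k₂ := (h₂.2.projEquivIn he).mono hsub
  -- The chain runs `D`, `D₁`, `D₀`, `D₂`, `D'`, where `D₀` is the reference connection of the
  -- class.
  exact ((hD₁.projEquivIn he).symm.trans k₁.symm).trans (k₂.trans (hD₂.projEquivIn he))

theorem twoFormComp_antisymm (ε : Π x : M, TangentSpace (𝓡 2) x [⋀^Fin 2]→ₗ[ℝ] ℝ)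
    (e : OpenPartialHomeomorph M Plane) (i j : Fin 2) (u : Plane) :
    twoFormComp ε e i j u = -twoFormComp ε e j i u := by
  have h := (ε (e.symm u)).map_swap (i := 0) (j := 1)
    ![coordField e j (e.symm u), coordField e i (e.symm u)] (by decide)
  rw [twoFormComp, twoFormComp, ← h]
  congr 1
  ext k
  fin_cases k <;> rfl

/-- The coordinate fields form a basis of the tangent space, and an alternating form of top degree
vanishing on a basis is zero. -/
theorem twoFormComp_ne_zero {ε : Π x : M, TangentSpace (𝓡 2) x [⋀^Fin 2]→ₗ[ℝ] ℝ}
    {e : OpenPartialHomeomorph M Plane} (he : e ∈ charts M) {u : Plane} (hu : u ∈ e.target)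
    (h0 : ε (e.symm u) ≠ 0) : twoFormComp ε e 0 1 u ≠ 0 := by
  obtain ⟨L, hL⟩ := isInvertible_mfderiv_chart he (e.map_target hu)
  let b : Module.Basis (Fin 2) ℝ (TangentSpace (𝓡 2) (e.symm u)) :=
    (EuclideanSpace.basisFun (Fin 2) ℝ).toBasis.map L.symm.toLinearEquiv
  have hb : ∀ i, b i = coordField e i (e.symm u) := by
    intro i
    rw [coordField, ← hL, ContinuousLinearMap.inverse_equiv]
    have h : (EuclideanSpace.basisFun (Fin 2) ℝ).toBasis i
        = (EuclideanSpace.single i (1 : ℝ) : Plane) := by simp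
    exact (Module.Basis.map_apply _ _ _).trans (congrArg L.symm h)
  have hb' : (![coordField e 0 (e.symm u), coordField e 1 (e.symm u)]) = b := by
    ext i
    fin_cases i <;> simp [hb]
  rw [twoFormComp, hb']
  exact fun h => h0 ((AlternatingMap.map_basis_eq_zero_iff b _).1 h)

theorem isUnimodularOn [T2Space M] [IsManifold (𝓡 2) ∞ M] {U : Set M} (hU : IsOpen U)
    {D : AffineConnection M} (hD : IsTorsionFreeConnectionOn U D)
    {ε : Π x : M, TangentSpace (𝓡 2) x [⋀^Fin 2]→ₗ[ℝ] ℝ} (hε : IsVolumeFormOn U ε)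
    (hDε : IsParallelOn U D ε) {e : OpenPartialHomeomorph M Plane} (he : e ∈ charts M) :
    IsUnimodularOn (chartDomain e U) (coeffs D e) (twoFormComp ε e) where
  isOpen := isOpen_chartDomain e hU
  smooth := contDiffOn_coeffs hU hD.smooth he
  symm k i j _ hu := coeffs_symm hD he k i j hu
  smooth_eps := hε.1 e he
  antisymm := twoFormComp_antisymm ε e
  ne_zero _ hu := twoFormComp_ne_zero he hu.1 (hε.2 _ hu.2)
  parallel := hDε e he

/-- Under either hypothesis, the equation has a solution relative to every smooth torsion-free
connection of the class, in every chart. -/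
theorem exists_solvesPEWIn [T2Space M] [IsManifold (𝓡 2) ∞ M] {p : ProjectiveStructure M}
    {U : Set M} (hU : IsOpen U) {D : AffineConnection M} (hD : p.MemOn U D)
    (hsol : AdmitsPEWSolutionOn p U ∨ AdmitsSkewRicciOn p U)
    {e : OpenPartialHomeomorph M Plane} (he : e ∈ charts M) :
    ∃ α : Fin 2 → Plane → ℝ, (∀ i, ContDiffOn ℝ ∞ (α i) (chartDomain e U)) ∧
      SolvesPEWIn (chartDomain e U) (coeffs D e) α := by
  obtain ⟨D', hD', α, hα, hs⟩ : ∃ D' : AffineConnection M, p.MemOn U D' ∧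
      ∃ α : Fin 2 → Plane → ℝ, (∀ i, ContDiffOn ℝ ∞ (α i) (chartDomain e U)) ∧
        SolvesPEWIn (chartDomain e U) (coeffs D' e) α := by
    rcases hsol with ⟨D', hD', α, hα, hs⟩ | ⟨D', hD', hs⟩
    · exact ⟨D', hD', formComp α e, hα e he, hs e he⟩
    · exact ⟨D', hD', _, fun _ => contDiffOn_const, solvesPEWIn_zero (hs e he)⟩
  obtain ⟨Υ, hΥ, h⟩ := hD.projEquivIn hD' he
  exact ⟨_, fun i => (hα i).sub (hΥ i), SolvesPEWIn.of_projective_change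
    (isOpen_chartDomain e hU) (contDiffOn_coeffs hU hD.1.smooth he)
    (fun k i j u hu => coeffs_symm hD.1 he k i j hu) hΥ hα h hs⟩

end Surface

end ProjectiveSurface

end

open ProjectiveSurface Polynomial in
theorem corollary2 {M : Type*} [TopologicalSpace M] [T2Space M] [ChartedSpace Plane M]
    [IsManifold (𝓡 2) ∞ M]
    -- a projective surface, an open subset, and a parallel volume form over it
    (p : ProjectiveStructure M) (U : Set M) (hU : IsOpen U)
    (D : AffineConnection M) (hD : p.MemOn U D)
    (ε : Π x : M, TangentSpace (𝓡 2) x [⋀^Fin 2]→ₗ[ℝ] ℝ)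
    (hε : IsVolumeFormOn U ε) (hDε : IsParallelOn U D ε)
    (hsol : AdmitsPEWSolutionOn p U ∨ AdmitsSkewRicciOn p U)
    -- a point of the open subset, in a chart, at which the invariant does not vanish
    (e : OpenPartialHomeomorph M Plane) (he : e ∈ charts M)
    (u : Plane) (hu : u ∈ chartDomain e U)
    (hρ : rho (coeffs D e) (twoFormComp ε e) u ≠ 0) :
    let Γ : Coeffs := coeffs D e
    let η : Fin 2 → Fin 2 → Plane → ℝ := twoFormComp ε e
    (resultant (P₁ Γ η u) (P₂ Γ η u) = 0 ∧
      resultant (P₂ Γ η u) (P₃ Γ η u) = 0 ∧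
      resultant (P₁ Γ η u) (P₃ Γ η u) = 0) ∧
    ((Q₁ Γ η u).comp (X ^ 2) = -20 * X ^ 2 * P₃ Γ η u + P₂ Γ η u ∧
      (Q₂ Γ η u).comp (X ^ 2) = -9 * P₃ Γ η u - P₁ Γ η u ∧
      (Q₃ Γ η u).comp (X ^ 2) = -C (20 / 9) * X ^ 2 * P₁ Γ η u - P₂ Γ η u) ∧
    ((sylvester43 (q₁ Γ η u) (q₂ Γ η u)).det = 0 ∧
      (sylvester34 (q₂ Γ η u) (q₃ Γ η u)).det = 0 ∧
      (sylvester44 (q₁ Γ η u) (q₃ Γ η u)).det = 0) := by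
  have h := isUnimodularOn hU hD.1 hε hDε he
  obtain ⟨α, hα, hs⟩ := exists_solvesPEWIn hU hD hsol he
  -- The common root is twice the value of `F` at the point.
  obtain ⟨h1, h2, h3⟩ := h.eval_eq_zero hα hs hu hρ
  obtain ⟨hres, hsyl⟩ := conclusion_of_common_root (coeffs D e) (twoFormComp ε e) u h1 h2 h3
  exact ⟨hres, ⟨Q₁_comp _ _ _, Q₂_comp _ _ _, Q₃_comp _ _ _⟩, hsyl⟩
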